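/- Let $G=(V,E,w)$ be a finite undirected graph with nonnegative symmetric edge weights ($w_{xy}=0$ when $(x,y)\notin E$), degrees $d_x=\sum_y w_{xy}$, and a non-empty sink $M\subseteq V$; put $n=|V|$, $m=|M|$. For $x\in V\setminus M$: - the electric flow $f_x$ is the unit flow from $x$ to $M$ that minimizes the energy $\mathcal E(f)=\frac12\sum_{(y,z)\in E} f_{yz}^2/w_{yz}$, and $R_x=\mathcal E(f_x)$ is the effective resistance; - for the random walk $(X_t)$ with $X_0=x$ and transition probabilities $w_{yz}/d_y$, let $\tau=\min\{t: X_t\in M\}$; the hitting time is $\mathrm{HT}_x=\mathbb E[\tau]$ and the escape time is $\mathrm{ET}_x=\mathbb E[1+\max\{t<\tau: X_t=x\}]$; - the elfs process is the Markov chain $(Y_t)$ with $Y_0=x$ that moves from $y\notin M$ to $y'$ with probability $\frac{1}{2R_y}\sum_{z:(y',z)\in E}(f_y)_{y'z}^2/w_{y'z}$ and stops in $M$; the electric hitting time is $\mathrm{EHT}_x=\mathbb E[\min\{t: Y_t\in M\}]$. For $x\in M$ all four quantities are $0$. Theorem. For all $\delta>0$ and $0<d_0\le D$ there are constants $c,C>0$,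 depending only on $\delta,d_0,D$, such that the following holds. Let $G$ be regular of degree $d\in[d_0,D]$, that is, $d_x=d$ for all $x$ (for unweighted graphs with at least one edge, $w\in\{0,1\}$, one can take $d_0=1$), and let $G$ be an expander with spectral gap at least $\delta$: every eigenvalue of the transition matrix $(w_{xy}/d)_{x,y}$ that has an eigenvector orthogonal to the constant vectors is at most $1-\delta$. Then for every non-empty $M\subseteq V$ and every $x\in V$, \[ R_x\le C,\qquad R_x\ge c \ \text{ if } x\notin M,\qquad \mathrm{ET}_x\le C\Big(1+\frac{n}{m^2}\Big), \] \[ \mathrm{EHT}_x\le C\min\Big\{m,\ \frac nm+\log n\Big\},\qquad \mathrm{HT}_x\le C\Big(\frac nm+\log n\Big). \] -/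

import Mathlib

open MeasureTheory ProbabilityTheory
open scoped ENNReal

noncomputable section

/-- An undirected graph on `V` with symmetric nonnegative edge weights; `(x, y)` is an edge iff
`w x y > 0`. Unweighted graphs are those with weights in `{0, 1}`. -/
structure WeightedGraph (V : Type*) where
  w : V → V → ℝ
  symm : ∀ x y, w x y = w y x
  nonneg : ∀ x y, 0 ≤ w x y

/-! ### Homogeneous Markov chains on a finite state space -/

section Chain

variable {V : Type*} [Fintype V]

open Classical in
/-- One step from `x` of the chain with transition probabilities `p`. A row of `p` that is not a
probability vector (there is no step to make) makes `x` absorbing. -/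
def stepLaw (p : V → V → ℝ) (x : V) : PMF V :=
  if h : (∀ y, 0 ≤ p x y) ∧ ∑ y, p x y = 1 then
    PMF.ofFintype (fun y => ENNReal.ofReal (p x y)) (by
      rw [← ENNReal.ofReal_sum_of_nonneg (fun y _ => h.1 y), h.2, ENNReal.ofReal_one])
  else PMF.pure x

variable [MeasurableSpace V] [DiscreteMeasurableSpace V]

/-- The transition probabilities as a Markov kernel. -/
def stepKernel (p : V → V → ℝ) : Kernel V V where
  toFun x := (stepLaw p x).toMeasure
  measurable' := Measurable.of_discrete

instance (p : V → V → ℝ) : IsMarkovKernel (stepKernel p) where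
  isProbabilityMeasure x := by
    change IsProbabilityMeasure (stepLaw p x).toMeasure
    infer_instance

/-- The kernel that gives the law of the `(t+1)`-st state from the history up to time `t`: it only
looks at the last state. -/
def historyKernel (p : V → V → ℝ) (t : ℕ) : Kernel (Finset.Iic t → V) V :=
  (stepKernel p).comap (fun h => h ⟨t, Finset.mem_Iic.2 le_rfl⟩) (measurable_pi_apply _)

instance (p : V → V → ℝ) (t : ℕ) : IsMarkovKernel (historyKernel p t) := by
  unfold historyKernel
  infer_instance

/-- The law, on the space of trajectories, of the Markov chain with transition probabilities `p`
started from `s`. -/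
def chainLaw (p : V → V → ℝ) (s : V) : Measure (ℕ → V) :=
  Kernel.traj (X := fun _ => V) (historyKernel p) 0 (fun _ => s)

end Chain

/-- The first time at which a trajectory is in `M` (`∞` if there is none). -/
def firstHit {V : Type*} (M : Finset V) (ω : ℕ → V) : ℝ≥0∞ :=
  ⨅ (t : ℕ) (_ : ω t ∈ M), (t : ℝ≥0∞)

/-- `1 + max {t < τ_M : ω t = s}`: the time at which a trajectory leaves `s` for the last time
before it hits `M` (`0` if there is no visit to `s` before hitting `M`). -/
def lastExit {V : Type*} (M : Finset V) (s : V) (ω : ℕ → V) : ℝ≥0∞ :=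
  ⨆ (t : ℕ) (_ : (t : ℝ≥0∞) < firstHit M ω ∧ ω t = s), ((t : ℝ≥0∞) + 1)

namespace WeightedGraph

variable {V : Type*} [Fintype V] (G : WeightedGraph V)

/-- The (weighted) degree. -/
def degree (x : V) : ℝ := ∑ y, G.w x y

/-- All vertices have degree `d`. -/
def IsRegular (d : ℝ) : Prop := ∀ x, G.degree x = d

/-! ### Electric flows -/

/-- `g` is a unit flow from `s` to the sink `M`, carried by the edges of `G`. -/
structure IsUnitFlow (s : V) (M : Finset V) (g : V → V → ℝ) : Prop where
  supported : ∀ x y, G.w x y = 0 → g x y = 0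
  antisymm : ∀ x y, g x y = -g y x
  source : ∑ y, g s y = 1
  sink : ∑ a ∈ M, ∑ y, g y a = 1
  conserved : ∀ x, x ≠ s → x ∉ M → ∑ z, g x z = 0

/-- The dissipated energy; `g x y ^ 2 / G.w x y = 0` off the edges of `G`. -/
def energy (g : V → V → ℝ) : ℝ := 1 / 2 * ∑ x, ∑ y, g x y ^ 2 / G.w x y

/-- `f` is a unit flow of least energy. -/
def IsElectricFlow (s : V) (M : Finset V) (f : V → V → ℝ) : Prop :=
  G.IsUnitFlow s M f ∧ ∀ g, G.IsUnitFlow s M g → G.energy f ≤ G.energy g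

open Classical in
/-- The unit electric flow from `s` to `M`, and zero if there is no such flow
(as for `s ∈ M`). -/
def electricFlow (s : V) (M : Finset V) : V → V → ℝ :=
  if h : ∃ f, G.IsElectricFlow s M f then h.choose else 0

/-- The effective resistance `R_s`. -/
def effectiveResistance (M : Finset V) (s : V) : ℝ := G.energy (G.electricFlow s M)

/-! ### The random walk and the elfs process -/

/-- Transition probabilities of the random walk. -/
def walkProb (x y : V) : ℝ := G.w x y / G.degree x

/-- Transition probabilities of the elfs process with sink `M`: from `x`, sample an edge with
probability proportional to the energy on it of the electric flow from `x` to `M`, and move to one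
of its two endpoints with probability `1 / 2` each. -/
def elfsProb (M : Finset V) (x y : V) : ℝ :=
  1 / (2 * G.effectiveResistance M x) * ∑ z, G.electricFlow x M y z ^ 2 / G.w y z

/-- The random walk has spectral gap `1 - λ₂` at least `δ`: an eigenvalue of the transition matrix
with an eigenvector orthogonal to the constants is at most `1 - δ`. (To be used for regular
graphs, whose transition matrix is symmetric.) -/
def HasSpectralGap (δ : ℝ) : Prop :=
  ∀ (μ : ℝ) (u : V → ℝ), u ≠ 0 → ∑ x, u x = 0 →
    Matrix.mulVec (Matrix.of G.walkProb) u = μ • u → μ ≤ 1 - δ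

variable [MeasurableSpace V] [DiscreteMeasurableSpace V]

/-- `HT_s`: the expected time at which the random walk from `s` hits `M`. -/
def hittingTime (M : Finset V) (s : V) : ℝ≥0∞ :=
  ∫⁻ ω, firstHit M ω ∂chainLaw G.walkProb s

/-- `ET_s`: the expected time at which the random walk from `s` leaves `s` for the last time
before hitting `M`. -/
def escapeTime (M : Finset V) (s : V) : ℝ≥0∞ :=
  ∫⁻ ω, lastExit M s ω ∂chainLaw G.walkProb s

/-- `EHT_s`: the expected number of steps after which the elfs process from `s` hits `M`. -/
def electricHittingTime (M : Finset V) (s : V) : ℝ≥0∞ :=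
  ∫⁻ ω, firstHit M ω ∂chainLaw (G.elfsProb M) s

end WeightedGraph

end

/-! Everything reduces to Dirichlet problems with zero values on `M`. Let `v` have unit source at
`x` and let `h` have Laplacian `d` off `M`. Thomson's principle identifies the electric flow with
the current of `v`, so `R_x = v x`; and `h` bounds the mean hitting time of the walk.

The gap gives a Poincaré inequality: fluctuations about the mean are controlled by the energy. The
energy of `v` is `v x`, and `v` vanishes on `M`, which bounds `R_x` above; `d * v x ≥ 1` bounds it
below. The energy of `h` is `d * ∑ h`, and vanishing at `m` points forces mean `O(n / m)`; running
the lazy walk for `O(log n)` steps turns this into a pointwise bound (`hitting_le`).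

The escape time is at most `d * ∑ v² / v x`. The fluctuation part of `∑ v²` contributes `1 / δ`, and
the mean part is `h x² / n` up to a constant, because `h x = d * ∑ v` by reciprocity (`escape_le`).

The elfs process lowers `h` on average by `d * ∑ v² / (2 * v x) ≥ 1 / 2`, so `2 * h` bounds its
hitting time. It also enters `M` in each step with probability at least `1 / (2 * R * d * m)`, by
Cauchy–Schwarz on the current into `M`, which gives the bound `O(m)`.

Only upper bounds on mean times are needed, so Lyapunov functions and supermartingales suffice. -/

noncomputable section

/-! ### Truncated, adapted versions of the hitting and last exit times. -/

section Trajectory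

variable {V : Type*}

/-- Overwrite everything after time `k` by a fixed state. -/
def extendHistory (k : ℕ) (h : Finset.Iic k → V) (y : V) (n : ℕ) : V :=
  if hn : n ≤ k then h ⟨n, Finset.mem_Iic.2 hn⟩ else y

/-- The trajectory has not met `M` up to time `k`. -/
def Avoids (M : Finset V) (k : ℕ) (ω : ℕ → V) : Prop := ∀ j ≤ k, ω j ∉ M

theorem avoids_congr {M : Finset V} {k : ℕ} {ω ω' : ℕ → V} (h : ∀ i ≤ k, ω i = ω' i) :
    Avoids M k ω ↔ Avoids M k ω' :=
  forall₂_congr fun j hj => by rw [h j hj]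

theorem avoids_update {M : Finset V} {j k : ℕ} (hj : j ≤ k) (ω : ℕ → V) (y : V) :
    Avoids M j (Function.update ω (k + 1) y) ↔ Avoids M j ω :=
  avoids_congr fun i hi => Function.update_of_ne (by omega) _ _

theorem Avoids.mono {M : Finset V} {j k : ℕ} (hj : j ≤ k) {ω : ℕ → V} (h : Avoids M k ω) :
    Avoids M j ω :=
  fun i hi => h i (hi.trans hj)

open Classical in
/-- The hitting time of `M` truncated at `k`. -/
def hitCount (M : Finset V) (k : ℕ) (ω : ℕ → V) : ℝ≥0∞ :=
  ∑ j ∈ Finset.range k, if Avoids M j ω then 1 else 0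

open Classical in
theorem hitCount_congr {M : Finset V} {k : ℕ} {ω ω' : ℕ → V} (h : ∀ i < k, ω i = ω' i) :
    hitCount M k ω = hitCount M k ω' :=
  Finset.sum_congr rfl fun _ hj => if_congr
    (avoids_congr fun i hi => h i (hi.trans_lt (Finset.mem_range.1 hj))) rfl rfl

theorem firstHit_le_iSup_hitCount (M : Finset V) (ω : ℕ → V) :
    firstHit M ω ≤ ⨆ k, hitCount M k ω := by
  classical
  have hfull : ∀ N, (∀ j < N, ω j ∉ M) → hitCount M N ω = N := fun N hN => by
    have : ∀ j ∈ Finset.range N, (if Avoids M j ω then (1 : ℝ≥0∞) else 0) = 1 := fun j hj =>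
      if_pos fun i hi => hN i (hi.trans_lt (Finset.mem_range.1 hj))
    rw [hitCount, Finset.sum_congr rfl this]
    simp
  by_cases h : ∃ t, ω t ∈ M
  · refine le_trans ?_ (le_iSup (fun k => hitCount M k ω) (Nat.find h))
    rw [hfull _ fun j hj => Nat.find_min h hj]
    exact iInf₂_le (f := fun (t : ℕ) (_ : ω t ∈ M) => (t : ℝ≥0∞)) _ (Nat.find_spec h)
  · push Not at h
    have : (⨆ k, hitCount M k ω) = ⊤ := by
      simp_rw [hfull _ fun j _ => h j]
      exact ENNReal.iSup_natCast
    rw [this]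
    exact le_top

open Classical in
/-- The time, among those up to `k`, at which a trajectory leaves `s` for the last time before it
hits `M`. -/
def lastVisit (M : Finset V) (s : V) (ω : ℕ → V) : ℕ → ℕ
  | 0 => 0
  | k + 1 => if Avoids M k ω ∧ ω k = s then k + 1 else lastVisit M s ω k

theorem lastVisit_le (M : Finset V) (s : V) (ω : ℕ → V) (k : ℕ) : lastVisit M s ω k ≤ k := by
  induction k with
  | zero => rfl
  | succ k ih =>
    rw [lastVisit]
    split_ifs <;> omega

theorem lastVisit_mono (M : Finset V) (s : V) (ω : ℕ → V) : Monotone (lastVisit M s ω) := by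
  refine monotone_nat_of_le_succ fun k => ?_
  have := lastVisit_le M s ω k
  rw [lastVisit]
  split_ifs <;> omega

open Classical in
theorem lastVisit_congr {M : Finset V} {s : V} {k : ℕ} {ω ω' : ℕ → V}
    (h : ∀ i < k, ω i = ω' i) : lastVisit M s ω k = lastVisit M s ω' k := by
  induction k with
  | zero => rfl
  | succ k ih =>
    have ha := avoids_congr (M := M) (k := k) fun i hi => h i (Nat.lt_succ_of_le hi)
    exact if_congr (and_congr ha (by rw [h k k.lt_succ_self])) rfl
      (ih fun i hi => h i (hi.trans k.lt_succ_self))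

theorem lastExit_le_iSup_lastVisit (M : Finset V) (s : V) (ω : ℕ → V) :
    lastExit M s ω ≤ ⨆ k, (lastVisit M s ω k : ℝ≥0∞) := by
  refine iSup₂_le fun t ht => le_trans ?_ (le_iSup _ (t + 1))
  have ha : Avoids M t ω := fun j hj hjM =>
    absurd ht.1 (not_lt.2 ((iInf₂_le (f := fun (t : ℕ) (_ : ω t ∈ M) => (t : ℝ≥0∞)) j hjM).trans (by exact_mod_cast hj)))
  rw [lastVisit, if_pos ⟨ha, ht.2⟩]
  push_cast
  exact le_rfl

end Trajectory

/-! ### The Markov property and Lyapunov bounds for mean times. -/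

section ChainBounds

variable {V : Type*} [Fintype V] [MeasurableSpace V] [DiscreteMeasurableSpace V]

theorem lintegral_stepKernel {p : V → V → ℝ} {x : V} (h0 : ∀ y, 0 ≤ p x y)
    (h1 : ∑ y, p x y = 1) (g : V → ℝ≥0∞) :
    ∫⁻ y, g y ∂stepKernel p x = ∑ y, ENNReal.ofReal (p x y) * g y := by
  have : stepKernel p x = (stepLaw p x).toMeasure := rfl
  rw [this, stepLaw, dif_pos ⟨h0, h1⟩, lintegral_fintype]
  refine Finset.sum_congr rfl fun y _ => ?_
  rw [PMF.toMeasure_apply_singleton _ _ (MeasurableSet.singleton y), PMF.ofFintype_apply, mul_comm]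

/-- The one-step mean of a nonnegative real function. -/
theorem lintegral_stepKernel_ofReal {p : V → V → ℝ} {x : V} (h0 : ∀ y, 0 ≤ p x y)
    (h1 : ∑ y, p x y = 1) {g : V → ℝ} (hg : ∀ y, 0 ≤ g y) :
    ∫⁻ y, ENNReal.ofReal (g y) ∂stepKernel p x = ENNReal.ofReal (∑ y, p x y * g y) := by
  rw [lintegral_stepKernel h0 h1,
    ENNReal.ofReal_sum_of_nonneg fun y _ => mul_nonneg (h0 y) (hg y)]
  exact Finset.sum_congr rfl fun y _ => (ENNReal.ofReal_mul (h0 y)).symm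

theorem measurable_of_dependsOn {k : ℕ} {F : (ℕ → V) → ℝ≥0∞} (hF : DependsOn F (Set.Iic k)) :
    Measurable F := by
  have : F = (fun h : Finset.Iic k → V => F (extendHistory k h (h ⟨k, Finset.mem_Iic.2 le_rfl⟩))) ∘
      Preorder.frestrictLe k := by
    funext ω
    refine hF fun n hn => ?_
    simp [extendHistory, Set.mem_Iic.1 hn]
  rw [this]
  exact Measurable.of_discrete.comp (Preorder.measurable_frestrictLe k)

/-- The Markov property for functionals of finitely many states: the joint law of the history up to
`k` and the next state is the composition product of the history law with the step kernel. -/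
theorem lintegral_chainLaw_succ (p : V → V → ℝ) (s : V) (k : ℕ) {F : (ℕ → V) → ℝ≥0∞}
    (hF : DependsOn F (Set.Iic (k + 1))) :
    ∫⁻ ω, F ω ∂chainLaw p s =
      ∫⁻ ω, ∫⁻ y, F (Function.update ω (k + 1) y) ∂stepKernel p (ω k) ∂chainLaw p s := by
  let Ψ : (Finset.Iic k → V) × V → ℝ≥0∞ := fun q => F (extendHistory k q.1 q.2)
  have hΨ : Measurable Ψ := Measurable.of_discrete
  have e1 : ∀ ω, F ω = Ψ (Preorder.frestrictLe k ω, ω (k + 1)) := fun ω => by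
    refine hF fun n hn => ?_
    by_cases h : n ≤ k
    · simp [extendHistory, h]
    · have : n = k + 1 := le_antisymm hn (by omega)
      simp [extendHistory, this]
  have e2 : ∀ ω y, F (Function.update ω (k + 1) y) = Ψ (Preorder.frestrictLe k ω, y) := fun ω y => by
    refine hF fun n hn => ?_
    by_cases h : n ≤ k
    · have : n ≠ k + 1 := by omega
      simp [extendHistory, h, this]
    · have : n = k + 1 := le_antisymm hn (by omega)
      subst this
      simp [extendHistory]
  have hm : Measurable fun ω : ℕ → V => (Preorder.frestrictLe (π := fun _ => V) k ω, ω (k + 1)) :=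
    (Preorder.measurable_frestrictLe k).prodMk (measurable_pi_apply _)
  have hprod := Kernel.partialTraj_compProd_eq_map_traj (X := fun _ => V) (κ := historyKernel p)
    (Nat.zero_le k) (x₀ := fun _ => s)
  have hmarg := Kernel.traj_map_frestrictLe_apply (X := fun _ => V) (κ := historyKernel p) 0 k
    (fun _ => s)
  simp_rw [e2]
  calc ∫⁻ ω, F ω ∂chainLaw p s
      = ∫⁻ q, Ψ q ∂(chainLaw p s).map
          fun ω => (Preorder.frestrictLe (π := fun _ => V) k ω, ω (k + 1)) := by
        rw [lintegral_map hΨ hm]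
        exact lintegral_congr e1
    _ = ∫⁻ h, ∫⁻ y, Ψ (h, y) ∂historyKernel p k h
          ∂Kernel.partialTraj (X := fun _ => V) (historyKernel p) 0 k (fun _ => s) := by
        rw [chainLaw, ← hprod, Measure.lintegral_compProd hΨ]
    _ = _ := by
        rw [← hmarg, lintegral_map Measurable.of_discrete (Preorder.measurable_frestrictLe k)]
        rfl

theorem lintegral_chainLaw_zero (p : V → V → ℝ) (s : V) {F : (ℕ → V) → ℝ≥0∞}
    (hF : DependsOn F (Set.Iic 0)) : ∫⁻ ω, F ω ∂chainLaw p s = F fun _ => s := by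
  have hp : IsProbabilityMeasure (chainLaw p s) := by
    unfold chainLaw
    infer_instance
  have h := Kernel.lintegral_traj (X := fun _ => V) (κ := historyKernel p) (a := 0) (fun _ => s)
    (measurable_of_dependsOn hF)
  rw [chainLaw, h, ← chainLaw]
  have : ∀ ω : ℕ → V, F (Function.updateFinset ω (Finset.Iic 0) fun _ => s) = F fun _ => s :=
    fun ω => hF fun n hn => by
      have : n = 0 := Nat.le_zero.1 hn
      subst this
      simp [Function.updateFinset]
  simp only [this, lintegral_const, measure_univ, mul_one]

theorem lintegral_chainLaw_le_of_supermartingale (p : V → V → ℝ) (s : V)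
    (W : ℕ → (ℕ → V) → ℝ≥0∞) (hW : ∀ k, DependsOn (W k) (Set.Iic k))
    (hstep : ∀ k ω, ∫⁻ y, W (k + 1) (Function.update ω (k + 1) y) ∂stepKernel p (ω k) ≤ W k ω)
    (k : ℕ) : ∫⁻ ω, W k ω ∂chainLaw p s ≤ W 0 fun _ => s := by
  induction k with
  | zero => exact (lintegral_chainLaw_zero p s (hW 0)).le
  | succ k ih =>
    rw [lintegral_chainLaw_succ p s k (hW (k + 1))]
    exact (lintegral_mono fun ω => hstep k ω).trans ih

/-- A random time that is the limit of adapted times dominated by a supermartingale. -/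
theorem lintegral_chainLaw_le_of_le_iSup (p : V → V → ℝ) (s : V) {T : (ℕ → V) → ℝ≥0∞}
    (A W : ℕ → (ℕ → V) → ℝ≥0∞) (hTA : ∀ ω, T ω ≤ ⨆ k, A k ω) (hA : Monotone A)
    (hAdep : ∀ k, DependsOn (A k) (Set.Iic k)) (hAW : ∀ k ω, A k ω ≤ W k ω)
    (hW : ∀ k, DependsOn (W k) (Set.Iic k))
    (hstep : ∀ k ω, ∫⁻ y, W (k + 1) (Function.update ω (k + 1) y) ∂stepKernel p (ω k) ≤ W k ω) :
    ∫⁻ ω, T ω ∂chainLaw p s ≤ W 0 fun _ => s := by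
  calc ∫⁻ ω, T ω ∂chainLaw p s ≤ ∫⁻ ω, ⨆ k, A k ω ∂chainLaw p s := lintegral_mono hTA
    _ = ⨆ k, ∫⁻ ω, A k ω ∂chainLaw p s :=
        lintegral_iSup (fun k => measurable_of_dependsOn (hAdep k)) hA
    _ ≤ W 0 fun _ => s := iSup_le fun k => (lintegral_mono (hAW k)).trans
        (lintegral_chainLaw_le_of_supermartingale p s W hW hstep k)

open Classical in
/-- A Lyapunov function that decreases by at least `1` in each step off `M` bounds the mean
hitting time of `M`. -/
theorem lintegral_firstHit_le (p : V → V → ℝ) (s : V) (M : Finset V) (φ : V → ℝ≥0∞)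
    (hφ : ∀ x, x ∉ M → 1 + ∫⁻ y, φ y ∂stepKernel p x ≤ φ x) :
    ∫⁻ ω, firstHit M ω ∂chainLaw p s ≤ φ s := by
  -- Time already spent plus the budget `φ` for the time still to come; absorption drops the budget.
  let W : ℕ → (ℕ → V) → ℝ≥0∞ := fun k ω =>
    hitCount M k ω + if Avoids M k ω then φ (ω k) else 0
  refine (lintegral_chainLaw_le_of_le_iSup p s (hitCount M) W (firstHit_le_iSup_hitCount M)
    ?_ ?_ (fun k ω => le_self_add) ?_ ?_).trans ?_
  · exact fun i j hij ω => Finset.sum_le_sum_of_subset (Finset.range_mono hij)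
  · exact fun k ω ω' h => hitCount_congr fun i hi => h i hi.le
  · intro k ω ω' h
    simp only [W, hitCount_congr (M := M) fun i (hi : i < k) => h i hi.le,
      avoids_congr (M := M) (k := k) fun i hi => h i hi, h k (Set.mem_Iic.2 le_rfl)]
  · intro k ω
    have hc : ∀ y, hitCount M (k + 1) (Function.update ω (k + 1) y) = hitCount M (k + 1) ω :=
      fun y => hitCount_congr fun i hi => Function.update_of_ne (by omega) _ _
    have hs : hitCount M (k + 1) ω = hitCount M k ω + if Avoids M k ω then 1 else 0 :=
      Finset.sum_range_succ _ _
    simp only [W, hc, Function.update_self, hs]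
    by_cases ha : Avoids M k ω
    · simp only [if_pos ha]
      calc _ ≤ ∫⁻ y, (hitCount M k ω + 1 + φ y) ∂stepKernel p (ω k) :=
            lintegral_mono fun y => by
              gcongr
              split_ifs
              exacts [le_rfl, zero_le]
        _ = hitCount M k ω + (1 + ∫⁻ y, φ y ∂stepKernel p (ω k)) := by
            rw [lintegral_add_left measurable_const, lintegral_const, measure_univ, mul_one,
              add_assoc]
        _ ≤ _ := by
            gcongr
            exact hφ _ (ha k le_rfl)
    · have hn : ∀ y, ¬ Avoids M (k + 1) (Function.update ω (k + 1) y) := fun y h =>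
        ha ((avoids_update le_rfl ω y).1 (h.mono k.le_succ))
      simp [ha, hn]
  · simp only [W, hitCount, Finset.range_zero, Finset.sum_empty, zero_add]
    split_ifs
    exacts [le_rfl, zero_le]

open Classical in
/-- If `u` dominates the probability to visit `s` before `M`, then any `l` with `u + P l ≤ l` off
`M` bounds the mean time of the last exit from `s` before `M`. -/
theorem lintegral_lastExit_le (p : V → V → ℝ) (s : V) (M : Finset V) (u l : V → ℝ≥0∞)
    (hs : 1 ≤ u s) (hu : ∀ x, x ∉ M → x ≠ s → ∫⁻ y, u y ∂stepKernel p x ≤ u x)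
    (hl : ∀ x, x ∉ M → u x + ∫⁻ y, l y ∂stepKernel p x ≤ l x) :
    ∫⁻ ω, lastExit M s ω ∂chainLaw p s ≤ l s := by
  -- A return to `s` after time `k` adds the whole gap `k - lastVisit` to the last exit time. The
  -- term with `u` pays for this gap, and `l` pays for the steps made from time `k` on.
  let W : ℕ → (ℕ → V) → ℝ≥0∞ := fun k ω => (lastVisit M s ω k : ℝ≥0∞) +
    if Avoids M k ω then ((k - lastVisit M s ω k : ℕ) : ℝ≥0∞) * u (ω k) + l (ω k) else 0
  refine (lintegral_chainLaw_le_of_le_iSup p s (fun k ω => (lastVisit M s ω k : ℝ≥0∞)) W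
    (lastExit_le_iSup_lastVisit M s) ?_ ?_ (fun k ω => le_self_add) ?_ ?_).trans ?_
  · exact fun i j hij ω => Nat.cast_le.2 (lastVisit_mono M s ω hij)
  · exact fun k ω ω' h => congrArg Nat.cast (lastVisit_congr fun i hi => h i hi.le)
  · intro k ω ω' h
    simp only [W, lastVisit_congr (M := M) (s := s) fun i (hi : i < k) => h i hi.le,
      avoids_congr (M := M) (k := k) fun i hi => h i hi, h k (Set.mem_Iic.2 le_rfl)]
  · intro k ω
    have hc : ∀ y, lastVisit M s (Function.update ω (k + 1) y) (k + 1) =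
        lastVisit M s ω (k + 1) :=
      fun y => lastVisit_congr fun i hi => Function.update_of_ne (by omega) _ _
    have hlast : ∀ j, lastVisit M s ω (j + 1) =
        if Avoids M j ω ∧ ω j = s then j + 1 else lastVisit M s ω j := fun j => rfl
    simp only [W, hc, Function.update_self]
    by_cases ha : Avoids M k ω
    · have hk := lastVisit_le M s ω k
      have hM : ω k ∉ M := ha k le_rfl
      generalize hv : lastVisit M s ω k = v at hk
      rw [if_pos ha]
      have hbound : ∀ a : ℕ, ∫⁻ y, ((a : ℝ≥0∞) +
            if Avoids M (k + 1) (Function.update ω (k + 1) y) then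
              ((k + 1 - a : ℕ) : ℝ≥0∞) * u y + l y else 0) ∂stepKernel p (ω k) ≤
          a + (((k + 1 - a : ℕ) : ℝ≥0∞) * ∫⁻ y, u y ∂stepKernel p (ω k) +
            ∫⁻ y, l y ∂stepKernel p (ω k)) := fun a => by
        rw [← lintegral_const_mul _ Measurable.of_discrete,
          ← lintegral_add_left Measurable.of_discrete]
        refine le_trans (lintegral_mono (g := fun y => (a : ℝ≥0∞) +
          (((k + 1 - a : ℕ) : ℝ≥0∞) * u y + l y)) fun y => ?_) ?_
        · dsimp only
          gcongr
          split_ifs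
          exacts [le_rfl, zero_le]
        · rw [lintegral_add_left measurable_const, lintegral_const, measure_univ, mul_one]
      refine (hbound _).trans ?_
      by_cases hx : ω k = s
      -- At `s` the gap closes: the recorded time rises by `(k - v) + 1`, which `1 ≤ u s` lets the
      -- two budgets cover.
      · rw [hlast, if_pos ⟨ha, hx⟩, Nat.sub_self, Nat.cast_zero, zero_mul, zero_add, hx]
        have e : ((k + 1 : ℕ) : ℝ≥0∞) = v + ((k - v : ℕ) : ℝ≥0∞) + 1 := by
          rw [← Nat.cast_add, Nat.add_sub_cancel' hk]
          push_cast
          rfl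
        have h1 := hl s (hx ▸ hM)
        calc _ = (v : ℝ≥0∞) + (((k - v : ℕ) : ℝ≥0∞) * 1 +
                (1 + ∫⁻ y, l y ∂stepKernel p s)) := by
              rw [e, mul_one]
              simp only [add_assoc]
          _ ≤ (v : ℝ≥0∞) + (((k - v : ℕ) : ℝ≥0∞) * u s +
                (u s + ∫⁻ y, l y ∂stepKernel p s)) := by gcongr
          _ ≤ _ := by gcongr
      -- Away from `s` the gap grows by one, and the extra copy of `u` is taken from `l`.
      · rw [hlast, if_neg fun h => hx h.2, hv, Nat.succ_sub hk]
        have h1 := hl _ hM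
        have h2 := hu _ hM hx
        rw [Nat.cast_succ (k - v)]
        calc _ ≤ (v : ℝ≥0∞) + ((((k - v : ℕ) : ℝ≥0∞) + 1) * u (ω k) +
                ∫⁻ y, l y ∂stepKernel p (ω k)) := by
              gcongr
          _ = (v : ℝ≥0∞) + (((k - v : ℕ) : ℝ≥0∞) * u (ω k) + (u (ω k) +
                ∫⁻ y, l y ∂stepKernel p (ω k))) := by ring
          _ ≤ _ := by gcongr
    · have hn : ∀ y, ¬ Avoids M (k + 1) (Function.update ω (k + 1) y) := fun y h =>
        ha ((avoids_update le_rfl ω y).1 (h.mono k.le_succ))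
      simp [ha, hn, hlast]
  · simp only [W, lastVisit, Nat.cast_zero, Nat.sub_self, zero_mul, zero_add]
    split_ifs
    exacts [le_rfl, zero_le]

end ChainBounds

namespace WeightedGraph

/-! ### Summation by parts for the Laplacian and its carré du champ. -/

section Laplacian

variable {V : Type*} [Fintype V] (G : WeightedGraph V)

/-- The graph Laplacian. -/
def lap (u : V → ℝ) (x : V) : ℝ := ∑ y, G.w x y * (u x - u y)

/-- The carré du champ `∑ y, w x y (u x - u y)²`. -/
def sqGradient (u : V → ℝ) (x : V) : ℝ := ∑ y, G.w x y * (u x - u y) ^ 2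

theorem sqGradient_nonneg (u : V → ℝ) (x : V) : 0 ≤ G.sqGradient u x :=
  Finset.sum_nonneg fun y _ => mul_nonneg (G.nonneg x y) (sq_nonneg _)

theorem lap_eq (u : V → ℝ) (x : V) : G.lap u x = G.degree x * u x - ∑ y, G.w x y * u y := by
  simp only [lap, degree, mul_sub, Finset.sum_sub_distrib, Finset.sum_mul]

theorem lap_add_smul (u v : V → ℝ) (t : ℝ) (x : V) :
    G.lap (fun y => u y + t * v y) x = G.lap u x + t * G.lap v x := by
  simp only [lap, Finset.mul_sum, ← Finset.sum_add_distrib]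
  exact Finset.sum_congr rfl fun y _ => by ring

theorem lap_sub_const (u : V → ℝ) (c : ℝ) (x : V) : G.lap (fun y => u y - c) x = G.lap u x := by
  simp [lap]

theorem sum_swap (F : V → V → ℝ) : ∑ x, ∑ y, F x y = 1 / 2 * ∑ x, ∑ y, (F x y + F y x) := by
  simp only [Finset.sum_add_distrib]
  rw [Finset.sum_comm (f := fun x y => F y x)]
  ring

theorem sum_mul_lap (u v : V → ℝ) :
    ∑ x, u x * G.lap v x = 1 / 2 * ∑ x, ∑ y, G.w x y * ((u x - u y) * (v x - v y)) := by
  simp only [lap, Finset.mul_sum]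
  rw [sum_swap]
  simp only [Finset.mul_sum]
  refine Finset.sum_congr rfl fun x _ => Finset.sum_congr rfl fun y _ => ?_
  rw [G.symm y x]
  ring

theorem sum_mul_lap_comm (u v : V → ℝ) : ∑ x, u x * G.lap v x = ∑ x, v x * G.lap u x := by
  simp only [sum_mul_lap, mul_comm]

theorem sum_mul_lap_self (u : V → ℝ) :
    ∑ x, u x * G.lap u x = 1 / 2 * ∑ x, G.sqGradient u x := by
  simp only [sum_mul_lap, sqGradient, sq]

theorem sum_lap (u : V → ℝ) : ∑ x, G.lap u x = 0 := by
  have := G.sum_mul_lap (fun _ => 1) u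
  simpa using this

theorem sq_lap_le (u : V → ℝ) (x : V) : G.lap u x ^ 2 ≤ G.degree x * G.sqGradient u x := by
  refine Finset.sum_sq_le_sum_mul_sum_of_sq_le_mul _ (fun y _ => G.nonneg x y)
    (fun y _ => mul_nonneg (G.nonneg x y) (sq_nonneg (u x - u y))) fun y _ => le_of_eq (by ring)

theorem sqGradient_eq (u : V → ℝ) (x : V) :
    G.sqGradient u x = 2 * (u x * G.lap u x) - G.lap (fun y => u y ^ 2) x := by
  simp only [sqGradient, lap, Finset.mul_sum, ← Finset.sum_sub_distrib]
  exact Finset.sum_congr rfl fun y _ => by ring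

/-- Self-adjointness moves the Laplacian from `u²` to the weight `φ`. With `φ` the hitting potential
and `u` the electric potential, both Laplacians are known off `M`; this is the source of the elfs
drift formula. -/
theorem sum_mul_sqGradient (φ u : V → ℝ) : ∑ x, φ x * G.sqGradient u x =
    2 * ∑ x, φ x * (u x * G.lap u x) - ∑ x, u x ^ 2 * G.lap φ x := by
  rw [G.sum_mul_lap_comm (fun y => u y ^ 2) φ, Finset.mul_sum, ← Finset.sum_sub_distrib]
  refine Finset.sum_congr rfl fun x _ => ?_
  rw [sqGradient_eq]
  ring

end Laplacian

/-! ### From the spectral gap to a Poincaré inequality. -/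

section Poincare

variable {V : Type*} [Fintype V] {G : WeightedGraph V} {d δ : ℝ}

theorem mulVec_walkProb (hd : 0 < d) (hG : G.IsRegular d) (u : V → ℝ) (x : V) :
    Matrix.mulVec (Matrix.of G.walkProb) u x = u x - G.lap u x / d := by
  have : Matrix.mulVec (Matrix.of G.walkProb) u x = (∑ y, G.w x y * u y) / d := by
    simp only [Matrix.mulVec, dotProduct, Matrix.of_apply, walkProb, hG x, Finset.sum_div]
    exact Finset.sum_congr rfl fun y _ => by ring
  rw [this, lap_eq, hG x]
  field_simp
  ring

theorem sum_walkProb_mul (hd : 0 < d) (hG : G.IsRegular d) (u : V → ℝ) (x : V) :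
    ∑ y, G.walkProb x y * u y = u x - G.lap u x / d :=
  mulVec_walkProb hd hG u x

/-- The minimum of the Rayleigh quotient of the Laplacian over functions of mean zero is attained
at an eigenfunction. -/
theorem exists_lap_eigenfunction (G : WeightedGraph V) {f : V → ℝ} (hf : f ≠ 0)
    (hf0 : ∑ x, f x = 0) : ∃ (c : ℝ) (u : V → ℝ), u ≠ 0 ∧ ∑ x, u x = 0 ∧
      (∀ x, G.lap u x = c * u x) ∧
      ∀ g : V → ℝ, ∑ x, g x = 0 → c * ∑ x, g x ^ 2 ≤ ∑ x, g x * G.lap g x := by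
  have hpos : ∀ g : V → ℝ, g ≠ 0 → 0 < ∑ x, g x ^ 2 := fun g hg => by
    obtain ⟨x, hx⟩ := Function.ne_iff.1 hg
    exact Finset.sum_pos' (fun y _ => sq_nonneg _) ⟨x, Finset.mem_univ x, sq_pos_of_ne_zero hx⟩
  have hnorm : ∀ (g : V → ℝ) (t : ℝ),
      ∑ x, (t * g x) * G.lap (fun y => t * g y) x = t ^ 2 * ∑ x, g x * G.lap g x := fun g t => by
    rw [Finset.mul_sum]
    refine Finset.sum_congr rfl fun x _ => ?_
    simp only [lap, Finset.mul_sum]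
    exact Finset.sum_congr rfl fun y _ => by ring
  let K : Set (V → ℝ) := {g | ∑ x, g x = 0 ∧ ∑ x, g x ^ 2 = 1}
  have hnormK : ∀ g : V → ℝ, g ≠ 0 → ∑ x, g x = 0 →
      (fun x => (√(∑ x, g x ^ 2))⁻¹ * g x) ∈ K := fun g hg hg0 => by
    have := hpos g hg
    refine ⟨by rw [← Finset.mul_sum, hg0, mul_zero], ?_⟩
    simp only [mul_pow, ← Finset.mul_sum, inv_pow, Real.sq_sqrt this.le]
    exact inv_mul_cancel₀ this.ne'
  have hK : IsCompact K := by
    refine IsCompact.of_isClosed_subset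
      (isCompact_univ_pi fun _ : V => isCompact_Icc (a := (-1 : ℝ)) (b := 1)) ?_ ?_
    · exact (isClosed_eq (by fun_prop) continuous_const).inter
        (isClosed_eq (by fun_prop) continuous_const)
    · intro g hg x _
      have : g x ^ 2 ≤ ∑ y, g y ^ 2 :=
        Finset.single_le_sum (f := fun y => g y ^ 2) (fun y _ => sq_nonneg _) (Finset.mem_univ x)
      rw [hg.2] at this
      exact abs_le.1 ((sq_le_one_iff_abs_le_one _).1 this)
  have hcont : Continuous fun g : V → ℝ => ∑ x, g x * G.lap g x := by
    simp only [lap]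
    fun_prop
  obtain ⟨u, hu, hmin⟩ := hK.exists_isMinOn ⟨_, hnormK f hf hf0⟩ hcont.continuousOn
  set c := ∑ x, u x * G.lap u x with hc
  have hray : ∀ g : V → ℝ, ∑ x, g x = 0 → c * ∑ x, g x ^ 2 ≤ ∑ x, g x * G.lap g x := by
    intro g hg0
    by_cases hg : g = 0
    · simp [hg]
    have h1 := hpos g hg
    have h2 : c ≤ _ := hmin (hnormK g hg hg0)
    simp only [hnorm, inv_pow, Real.sq_sqrt h1.le] at h2
    rwa [inv_mul_eq_div, le_div_iff₀ h1] at h2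
  refine ⟨c, u, ?_, hu.1, ?_, hray⟩
  · rintro rfl
    simpa using hu.2
  -- Perturbing the minimizer along its own residual `g` makes the Rayleigh bound a quadratic in `t`
  -- with zero constant term and linear coefficient `2 * ∑ g²`. Nonnegativity for all `t` forces `g
  -- = 0`.
  set g : V → ℝ := fun x => G.lap u x - c * u x with hg
  have hg0 : ∑ x, g x = 0 := by
    rw [hg, Finset.sum_sub_distrib, ← Finset.mul_sum, hu.1, G.sum_lap, mul_zero, sub_zero]
  set b := ∑ x, g x * G.lap g x - c * ∑ x, g x ^ 2 with hb
  have hquad : ∀ t : ℝ, 0 ≤ t * t * b + 2 * t * ∑ x, g x ^ 2 := fun t => by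
    have h1 := hray (fun x => u x + t * g x) (by
      rw [Finset.sum_add_distrib, ← Finset.mul_sum, hu.1, hg0, mul_zero, add_zero])
    have h2 : ∑ x, (u x + t * g x) * G.lap (fun y => u y + t * g y) x =
        c + 2 * t * ∑ x, g x * G.lap u x + t * t * ∑ x, g x * G.lap g x := by
      rw [hc]
      have := G.sum_mul_lap_comm u g
      simp only [lap_add_smul, Finset.mul_sum] at this ⊢
      rw [← sub_eq_zero] at this
      have e : ∑ x, (u x + t * g x) * (G.lap u x + t * G.lap g x) =
          ∑ x, u x * G.lap u x + ∑ x, 2 * t * (g x * G.lap u x) +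
            ∑ x, t * t * (g x * G.lap g x) +
            t * (∑ x, u x * G.lap g x - ∑ x, g x * G.lap u x) := by
        simp only [mul_sub, Finset.mul_sum, ← Finset.sum_add_distrib, ← Finset.sum_sub_distrib]
        exact Finset.sum_congr rfl fun x _ => by ring
      rw [e, this]
      ring
    have h3 : ∑ x, (u x + t * g x) ^ 2 =
        1 + 2 * t * ∑ x, u x * g x + t * t * ∑ x, g x ^ 2 := by
      rw [← hu.2]
      simp only [Finset.mul_sum, ← Finset.sum_add_distrib]
      exact Finset.sum_congr rfl fun x _ => by ring
    have h4 : ∑ x, g x ^ 2 = ∑ x, g x * G.lap u x - c * ∑ x, u x * g x := by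
      simp only [Finset.mul_sum, ← Finset.sum_sub_distrib]
      exact Finset.sum_congr rfl fun x _ => by simp only [hg]; ring
    rw [h2, h3] at h1
    rw [hb]
    linear_combination h1 - 2 * t * h4
  have hzero : ∑ x, g x ^ 2 = 0 := by
    by_contra hne
    have hs : 0 < ∑ x, g x ^ 2 := lt_of_le_of_ne (Finset.sum_nonneg fun x _ => sq_nonneg _)
      (Ne.symm hne)
    set S := ∑ x, g x ^ 2
    -- A step this short keeps the quadratic term at most half the size of the negative linear one.
    have h1 := hquad (-(S / (|b| + 1)))
    have hb1 : 0 < |b| + 1 := by positivity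
    have h2 : S / (|b| + 1) * b ≤ S := by
      rw [div_mul_eq_mul_div, div_le_iff₀ hb1]
      exact mul_le_mul_of_nonneg_left ((le_abs_self b).trans (by linarith)) hs.le
    have h3 : 0 < S / (|b| + 1) := by positivity
    nlinarith [mul_le_mul_of_nonneg_left h2 h3.le, mul_pos h3 hs]
  intro x
  have := (Finset.sum_eq_zero_iff_of_nonneg fun y _ => sq_nonneg (g y)).1 hzero x
    (Finset.mem_univ x)
  have := pow_eq_zero_iff (two_ne_zero) |>.1 this
  simp only [hg] at this
  linarith

/-- A Laplacian eigenvalue `c` is the eigenvalue `1 - c / d` of the walk, so the gap gives `c ≥ δ *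
d` for the minimal Rayleigh quotient. -/
theorem poincare (hd : 0 < d) (hG : G.IsRegular d) (hgap : G.HasSpectralGap δ) {f : V → ℝ}
    (hf : ∑ x, f x = 0) : δ * d * ∑ x, f x ^ 2 ≤ ∑ x, f x * G.lap f x := by
  by_cases h0 : f = 0
  · simp [h0]
  obtain ⟨c, u, hu, hu0, he, hmin⟩ := exists_lap_eigenfunction G h0 hf
  have h1 := hgap (1 - c / d) u hu hu0 (by
    funext x
    rw [mulVec_walkProb hd hG, he]
    simp only [Pi.smul_apply, smul_eq_mul]
    ring)
  have h2 : δ * d ≤ c := by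
    rw [← le_div_iff₀ hd]
    linarith
  exact (mul_le_mul_of_nonneg_right h2 (Finset.sum_nonneg fun x _ => sq_nonneg _)).trans
    (hmin f hf)

/-- The mean of a function. -/
def mean (f : V → ℝ) : ℝ := (∑ x, f x) / Fintype.card V

theorem card_mul_mean (f : V → ℝ) : Fintype.card V * mean f = ∑ x, f x := by
  by_cases h : Fintype.card V = 0
  · have := Fintype.card_eq_zero_iff.1 h
    simp
  · rw [mean]
    field_simp

theorem sum_sub_mean (f : V → ℝ) : ∑ x, (f x - mean f) = 0 := by
  rw [Finset.sum_sub_distrib, ← card_mul_mean]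
  simp

theorem poincare_mean (hd : 0 < d) (hG : G.IsRegular d) (hgap : G.HasSpectralGap δ) (f : V → ℝ) :
    δ * d * ∑ x, (f x - mean f) ^ 2 ≤ ∑ x, f x * G.lap f x := by
  refine (poincare hd hG hgap (sum_sub_mean f)).trans_eq ?_
  simp only [lap_sub_const, sub_mul, Finset.sum_sub_distrib, ← Finset.mul_sum, G.sum_lap,
    mul_zero, sub_zero]

theorem sum_sq_eq (f : V → ℝ) :
    ∑ x, f x ^ 2 = ∑ x, (f x - mean f) ^ 2 + Fintype.card V * mean f ^ 2 := by
  have h : ∀ x, f x ^ 2 = (f x - mean f) ^ 2 + 2 * mean f * (f x - mean f) + mean f ^ 2 :=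
    fun x => by ring
  rw [Finset.sum_congr rfl fun x _ => h x]
  rw [Finset.sum_add_distrib, Finset.sum_add_distrib, ← Finset.mul_sum, sum_sub_mean]
  simp

theorem card_mul_mean_sq_le {M : Finset V} {f : V → ℝ} (hf : ∀ x ∈ M, f x = 0) :
    M.card * mean f ^ 2 ≤ ∑ x, (f x - mean f) ^ 2 := by
  calc (M.card : ℝ) * mean f ^ 2 = ∑ x ∈ M, (f x - mean f) ^ 2 := by
        rw [Finset.sum_congr rfl fun x hx => by rw [hf x hx]]
        simp
    _ ≤ _ := Finset.sum_le_sum_of_subset_of_nonneg (Finset.subset_univ M)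
        fun x _ _ => sq_nonneg _

/-- A function of zero energy that vanishes on a nonempty set is zero. -/
theorem eq_zero_of_energy (hδ : 0 < δ) (hd : 0 < d) (hG : G.IsRegular d)
    (hgap : G.HasSpectralGap δ) {M : Finset V} (hM : M.Nonempty) {f : V → ℝ}
    (hf : ∀ x ∈ M, f x = 0) (hE : ∑ x, f x * G.lap f x ≤ 0) : f = 0 := by
  have h1 := (poincare_mean hd hG hgap f).trans hE
  have h2 : ∑ x, (f x - mean f) ^ 2 = 0 := le_antisymm
    (nonpos_of_mul_nonpos_right h1 (by positivity)) (Finset.sum_nonneg fun x _ => sq_nonneg _)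
  have h3 : ∀ x, f x = mean f := fun x => by
    have := (Finset.sum_eq_zero_iff_of_nonneg fun y _ => sq_nonneg (f y - mean f)).1 h2 x
      (Finset.mem_univ x)
    exact sub_eq_zero.1 (pow_eq_zero_iff two_ne_zero |>.1 this)
  obtain ⟨a, ha⟩ := hM
  funext x
  rw [h3 x, ← h3 a, hf a ha, Pi.zero_apply]

end Poincare

/-! ### The Dirichlet problem: solvability, reciprocity, positivity. -/

section Potential

variable {V : Type*} [Fintype V] {G : WeightedGraph V} {d δ : ℝ} {M : Finset V}

/-- `u` solves the Dirichlet problem `lap u = g` off `M`, `u = 0` on `M`. -/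
structure IsPotential (G : WeightedGraph V) (M : Finset V) (g u : V → ℝ) : Prop where
  eq_zero : ∀ x ∈ M, u x = 0
  lap_eq : ∀ x, x ∉ M → G.lap u x = g x

/-- The Dirichlet operator has trivial kernel, since a kernel element has zero energy and vanishes
on `M`; in finite dimension it is therefore onto. -/
theorem exists_isPotential (hδ : 0 < δ) (hd : 0 < d) (hG : G.IsRegular d)
    (hgap : G.HasSpectralGap δ) (hM : M.Nonempty) (g : V → ℝ) : ∃ u, G.IsPotential M g u := by
  classical
  let T : (V → ℝ) →ₗ[ℝ] (V → ℝ) :=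
    { toFun := fun u x => if x ∈ M then u x else G.lap u x
      map_add' := fun u v => by
        funext x
        have := G.lap_add_smul u v 1 x
        simp only [one_mul] at this
        simp only [Pi.add_apply]
        split_ifs
        · rfl
        · exact this
      map_smul' := fun t u => by
        funext x
        simp only [RingHom.id_apply, Pi.smul_apply, smul_eq_mul]
        split_ifs
        · rfl
        · simp only [lap, Finset.mul_sum, Pi.smul_apply, smul_eq_mul]
          exact Finset.sum_congr rfl fun y _ => by ring }
  have hT : ∀ u x, T u x = if x ∈ M then u x else G.lap u x := fun u x => rfl
  have hinj : Function.Injective T := by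
    refine (injective_iff_map_eq_zero T).2 fun u hu => ?_
    have h1 : ∀ x ∈ M, u x = 0 := fun x hx => by
      have := congrFun hu x
      rwa [hT, if_pos hx] at this
    refine eq_zero_of_energy hδ hd hG hgap hM h1 (Finset.sum_nonpos fun x _ => ?_)
    by_cases hx : x ∈ M
    · rw [h1 x hx, zero_mul]
    · have := congrFun hu x
      rw [hT, if_neg hx] at this
      rw [this, Pi.zero_apply, mul_zero]
  obtain ⟨u, hu⟩ := LinearMap.injective_iff_surjective.1 hinj fun x => if x ∈ M then 0 else g x
  refine ⟨u, fun x hx => ?_, fun x hx => ?_⟩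
  · have := congrFun hu x
    simpa [hT, hx] using this
  · have := congrFun hu x
    simpa [hT, hx] using this

variable {g g' u u' : V → ℝ}

theorem IsPotential.mul_lap (hu : G.IsPotential M g u) (hf : ∀ x ∈ M, u' x = 0) (x : V) :
    u' x * G.lap u x = u' x * g x := by
  by_cases hx : x ∈ M
  · rw [hf x hx, zero_mul, zero_mul]
  · rw [hu.lap_eq x hx]

/-- Symmetry of the Green function. Taking a unit mass for one source evaluates the other potential
at a point as a sum against `v`. -/
theorem IsPotential.reciprocity (hu : G.IsPotential M g u) (hu' : G.IsPotential M g' u') :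
    ∑ x, u' x * g x = ∑ x, u x * g' x := by
  rw [← Finset.sum_congr rfl fun x _ => hu.mul_lap hu'.eq_zero x,
    ← Finset.sum_congr rfl fun x _ => hu'.mul_lap hu.eq_zero x, G.sum_mul_lap_comm]

theorem IsPotential.energy_eq (hu : G.IsPotential M g u) :
    ∑ x, u x * G.lap u x = ∑ x, u x * g x :=
  Finset.sum_congr rfl fun x _ => hu.mul_lap hu.eq_zero x

theorem IsPotential.nonneg (hδ : 0 < δ) (hd : 0 < d) (hG : G.IsRegular d)
    (hgap : G.HasSpectralGap δ) (hM : M.Nonempty) (hu : G.IsPotential M g u)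
    (hg : ∀ x, 0 ≤ g x) (x : V) : 0 ≤ u x := by
  -- Testing the equation against the negative part of `u` shows that this part has nonpositive
  -- energy.
  let n : V → ℝ := fun x => max (-u x) 0
  have hn : ∀ x ∈ M, n x = 0 := fun x hx => by simp [n, hu.eq_zero x hx]
  have h1 : 0 ≤ ∑ x, n x * G.lap u x := Finset.sum_nonneg fun x _ => by
    rw [hu.mul_lap hn]
    exact mul_nonneg (le_max_right _ _) (hg x)
  have h2 : ∑ x, n x * G.lap n x ≤ - ∑ x, n x * G.lap u x := by
    rw [sum_mul_lap, sum_mul_lap, ← mul_neg, ← Finset.sum_neg_distrib]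
    simp only [← Finset.sum_neg_distrib]
    refine mul_le_mul_of_nonneg_left (Finset.sum_le_sum fun x _ => Finset.sum_le_sum
      fun y _ => ?_) (by norm_num)
    rw [← mul_neg]
    refine mul_le_mul_of_nonneg_left ?_ (G.nonneg x y)
    simp only [n]
    rcases le_total (-u x) 0 with hx | hx <;> rcases le_total (-u y) 0 with hy | hy <;>
      simp only [hx, hy, max_eq_left, max_eq_right] <;> nlinarith
  have h3 := congrFun (eq_zero_of_energy hδ hd hG hgap hM hn (h2.trans (by linarith))) x
  have : -u x ≤ n x := le_max_left _ _
  rw [h3, Pi.zero_apply] at this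
  linarith

end Potential

section UnitMass

variable {V : Type*}

open Classical in
/-- The unit mass at `x`. -/
def unitMass (x y : V) : ℝ := if y = x then 1 else 0

theorem unitMass_self (x : V) : unitMass x x = 1 := if_pos rfl

theorem unitMass_of_ne {x y : V} (h : y ≠ x) : unitMass x y = 0 := if_neg h

theorem unitMass_nonneg (x y : V) : 0 ≤ unitMass x y := by
  unfold unitMass
  split_ifs <;> norm_num

end UnitMass

/-! ### Thomson's principle: the electric flow is the current of a potential. -/

section ElectricFlow

variable {V : Type*} [Fintype V] {G : WeightedGraph V} {M : Finset V} {x : V} {v : V → ℝ}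

theorem sum_mul_unitMass (x : V) (f : V → ℝ) : ∑ y, f y * unitMass x y = f x := by
  rw [Finset.sum_eq_single x (fun y _ h => by rw [unitMass_of_ne h, mul_zero])
    fun h => absurd (Finset.mem_univ x) h, unitMass_self, mul_one]

theorem sum_sum_eq_zero_of_antisymm {g : V → V → ℝ} (hg : ∀ y z, g y z = -g z y) :
    ∑ y, ∑ z, g y z = 0 := by
  rw [sum_swap]
  simp [fun y z => (by rw [hg y z]; ring : g y z + g z y = 0)]

/-- With the source inside `M`, conservation everywhere outside makes the net flow into `M` zero
instead of one. -/
theorem IsUnitFlow.not_mem {g : V → V → ℝ} (hg : G.IsUnitFlow x M g) : x ∉ M := by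
  classical
  intro hx
  have h1 : ∑ a ∈ M, ∑ y, g a y = -1 := by
    rw [← hg.sink, ← Finset.sum_neg_distrib]
    refine Finset.sum_congr rfl fun a _ => ?_
    rw [← Finset.sum_neg_distrib]
    exact Finset.sum_congr rfl fun y _ => hg.antisymm a y
  have h2 : ∑ a ∈ M, ∑ y, g a y = 0 := by
    rw [← sum_sum_eq_zero_of_antisymm hg.antisymm]
    refine Finset.sum_subset (Finset.subset_univ M) fun y _ hy => hg.conserved y ?_ hy
    rintro rfl
    exact hy hx
  linarith

theorem effectiveResistance_of_mem (hx : x ∈ M) : G.effectiveResistance M x = 0 := by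
  have : ¬ ∃ f, G.IsElectricFlow x M f := fun ⟨f, hf⟩ => hf.1.not_mem hx
  rw [effectiveResistance, electricFlow, dif_neg this]
  simp [energy]

/-- The current of a potential. -/
def current (G : WeightedGraph V) (v : V → ℝ) (y z : V) : ℝ := G.w y z * (v y - v z)

theorem isUnitFlow_current (hv : G.IsPotential M (unitMass x) v) (hx : x ∉ M) :
    G.IsUnitFlow x M (G.current v) where
  supported y z h := by rw [current, h, zero_mul]
  antisymm y z := by rw [current, current, G.symm z y]; ring
  source := (hv.lap_eq x hx).trans (unitMass_self x)
  sink := by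
    classical
    have h1 : ∀ a, ∑ y, G.current v y a = -G.lap v a := fun a => by
      rw [lap, ← Finset.sum_neg_distrib]
      exact Finset.sum_congr rfl fun y _ => by rw [current, G.symm y a]; ring
    have h2 : ∑ a ∈ Mᶜ, G.lap v a = 1 := by
      rw [Finset.sum_congr rfl fun a ha => hv.lap_eq a (Finset.mem_compl.1 ha),
        Finset.sum_eq_single x (fun y _ h => unitMass_of_ne h)
          fun h => absurd (Finset.mem_compl.2 hx) h, unitMass_self]
    have h3 := Finset.sum_add_sum_compl M (G.lap v)
    rw [G.sum_lap, h2] at h3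
    simp only [h1, Finset.sum_neg_distrib]
    linarith
  conserved y hy hyM := (hv.lap_eq y hyM).trans (unitMass_of_ne hy)

/-- Pythagoras: the difference of two unit flows is divergence-free off `M`, hence orthogonal to the
gradient of a function vanishing on `M`. Existence, uniqueness and energy of the minimizer all
follow. -/
theorem IsUnitFlow.energy_eq {g : V → V → ℝ} (hg : G.IsUnitFlow x M g)
    (hv : G.IsPotential M (unitMass x) v) :
    G.energy g = v x + 1 / 2 * ∑ y, ∑ z, (g y z - G.current v y z) ^ 2 / G.w y z := by
  have hx := hg.not_mem
  have hf := isUnitFlow_current hv hx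
  have hdiv : ∀ y, v y * ∑ z, (g y z - G.current v y z) = 0 := fun y => by
    by_cases hy : y ∈ M
    · rw [hv.eq_zero y hy, zero_mul]
    rw [Finset.sum_sub_distrib]
    by_cases hyx : y = x
    · rw [hyx, hg.source, hf.source, sub_self, mul_zero]
    · rw [hg.conserved y hyx hy, hf.conserved y hyx hy, sub_self, mul_zero]
  have hcross : ∑ y, ∑ z, (v y - v z) * (g y z - G.current v y z) = 0 := by
    have h1 : ∑ y, ∑ z, v y * (g y z - G.current v y z) = 0 := by
      simp only [← Finset.mul_sum, hdiv, Finset.sum_const_zero]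
    rw [sum_swap] at h1
    rw [← mul_eq_zero.1 h1 |>.resolve_left (by norm_num)]
    refine Finset.sum_congr rfl fun y _ => Finset.sum_congr rfl fun z _ => ?_
    rw [hg.antisymm z y, hf.antisymm z y]
    ring
  have hself : v x = 1 / 2 * ∑ y, ∑ z, G.w y z * (v y - v z) ^ 2 := by
    have h1 := hv.energy_eq
    rw [sum_mul_unitMass, sum_mul_lap_self] at h1
    exact h1.symm
  have hpt : ∀ y z, g y z ^ 2 / G.w y z = G.w y z * (v y - v z) ^ 2 +
      2 * ((v y - v z) * (g y z - G.current v y z)) +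
      (g y z - G.current v y z) ^ 2 / G.w y z := fun y z => by
    by_cases h : G.w y z = 0
    · simp [h, hg.supported y z h, current]
    · rw [current]
      field_simp
      ring
  simp only [energy, hpt, Finset.sum_add_distrib, ← Finset.mul_sum]
  rw [hcross, hself]
  ring

theorem electricFlow_eq (hv : G.IsPotential M (unitMass x) v) (hx : x ∉ M) :
    G.electricFlow x M = G.current v := by
  have hf := isUnitFlow_current hv hx
  have hnn : ∀ (g : V → V → ℝ) (y z : V), 0 ≤ (g y z - G.current v y z) ^ 2 / G.w y z :=
    fun g y z => div_nonneg (sq_nonneg _) (G.nonneg y z)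
  have hsum : ∀ g : V → V → ℝ, 0 ≤ ∑ y, ∑ z, (g y z - G.current v y z) ^ 2 / G.w y z := fun g =>
    Finset.sum_nonneg fun y _ => Finset.sum_nonneg fun z _ => hnn g y z
  have hself : G.energy (G.current v) = v x := by
    rw [hf.energy_eq hv]
    simp
  have hex : ∃ f, G.IsElectricFlow x M f := ⟨G.current v, hf, fun g hg => by
    rw [hself, hg.energy_eq hv]
    linarith [hsum g]⟩
  rw [electricFlow, dif_pos hex]
  obtain ⟨hg, hmin⟩ := hex.choose_spec
  set g := hex.choose
  have h1 := hmin _ hf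
  rw [hself, hg.energy_eq hv] at h1
  have h2 : ∑ y, ∑ z, (g y z - G.current v y z) ^ 2 / G.w y z = 0 :=
    le_antisymm (by linarith) (hsum g)
  funext y z
  have h3 := (Finset.sum_eq_zero_iff_of_nonneg fun y _ => Finset.sum_nonneg
    fun z _ => hnn g y z).1 h2 y (Finset.mem_univ y)
  have h4 := (Finset.sum_eq_zero_iff_of_nonneg fun z _ => hnn g y z).1 h3 z (Finset.mem_univ z)
  by_cases h : G.w y z = 0
  · rw [hg.supported y z h, hf.supported y z h]
  · rcases div_eq_zero_iff.1 h4 with h5 | h5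
    · exact sub_eq_zero.1 (pow_eq_zero_iff two_ne_zero |>.1 h5)
    · exact absurd h5 h

theorem effectiveResistance_eq (hv : G.IsPotential M (unitMass x) v) (hx : x ∉ M) :
    G.effectiveResistance M x = v x := by
  rw [effectiveResistance, electricFlow_eq hv hx, (isUnitFlow_current hv hx).energy_eq hv]
  simp

theorem elfsProb_eq (hv : G.IsPotential M (unitMass x) v) (hx : x ∉ M) (y : V) :
    G.elfsProb M x y = 1 / (2 * v x) * G.sqGradient v y := by
  rw [elfsProb, effectiveResistance_eq hv hx, electricFlow_eq hv hx, sqGradient]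
  congr 1
  refine Finset.sum_congr rfl fun z _ => ?_
  by_cases h : G.w y z = 0
  · simp [h]
  · rw [current]
    field_simp

end ElectricFlow

/-! ### Quantitative bounds on potentials in an expander. -/

section Bounds

variable {V : Type*} [Fintype V] {G : WeightedGraph V} {d δ : ℝ} {M : Finset V} {x : V}
  {v h : V → ℝ}

theorem one_le_degree_mul_resistance (hδ : 0 < δ) (hd : 0 < d) (hG : G.IsRegular d)
    (hgap : G.HasSpectralGap δ) (hM : M.Nonempty) (hv : G.IsPotential M (unitMass x) v)
    (hx : x ∉ M) : 1 ≤ d * v x := by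
  have h1 := hv.lap_eq x hx
  rw [unitMass_self, G.lap_eq, hG x] at h1
  have : 0 ≤ ∑ y, G.w x y * v y := Finset.sum_nonneg fun y _ => mul_nonneg (G.nonneg x y)
    (hv.nonneg hδ hd hG hgap hM (unitMass_nonneg x) y)
  linarith

theorem sum_sub_mean_sq_le_resistance (hd : 0 < d) (hG : G.IsRegular d)
    (hgap : G.HasSpectralGap δ) (hv : G.IsPotential M (unitMass x) v) :
    δ * d * ∑ y, (v y - mean v) ^ 2 ≤ v x := by
  refine (poincare_mean hd hG hgap v).trans_eq ?_
  rw [hv.energy_eq, sum_mul_unitMass]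

/-- The potential takes the values `v x` and `0`, so its squared fluctuation is at least `v x ^ 2 /
2`, while Poincaré bounds it by `v x / (δ * d)`. -/
theorem resistance_le (hδ : 0 < δ) (hd : 0 < d) (hG : G.IsRegular d)
    (hgap : G.HasSpectralGap δ) (hM : M.Nonempty) (hv : G.IsPotential M (unitMass x) v)
    (hx : x ∉ M) : δ * d * v x ≤ 2 := by
  classical
  obtain ⟨a, ha⟩ := hM
  have hR : 0 < v x := by
    have := one_le_degree_mul_resistance hδ hd hG hgap ⟨a, ha⟩ hv hx
    exact pos_of_mul_pos_right (by linarith) hd.le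
  have h1 := sum_sub_mean_sq_le_resistance hd hG hgap hv
  have hne : x ≠ a := fun h => hx (h ▸ ha)
  have h2 : (v x - mean v) ^ 2 + (v a - mean v) ^ 2 ≤ ∑ y, (v y - mean v) ^ 2 := by
    rw [← Finset.sum_pair (f := fun y => (v y - mean v) ^ 2) hne]
    exact Finset.sum_le_sum_of_subset_of_nonneg (Finset.subset_univ _) fun y _ _ => sq_nonneg _
  rw [hv.eq_zero a ha] at h2
  have h3 : v x ^ 2 ≤ 2 * ∑ y, (v y - mean v) ^ 2 := by
    nlinarith [sq_nonneg (v x - 2 * mean v)]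
  have h4 : (δ * d * v x) * v x ≤ 2 * v x := by
    have := mul_le_mul_of_nonneg_left h3 (mul_pos hδ hd).le
    nlinarith
  exact le_of_mul_le_mul_right h4 hR

theorem sum_elfsProb (hv : G.IsPotential M (unitMass x) v) (hx : x ∉ M) (hR : 0 < v x) :
    ∑ y, G.elfsProb M x y = 1 := by
  have h1 := hv.energy_eq
  rw [sum_mul_unitMass, sum_mul_lap_self] at h1
  simp only [elfsProb_eq hv hx, ← Finset.mul_sum]
  have h2 : ∑ y, G.sqGradient v y = 2 * v x := by linarith
  rw [h2]
  field_simp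

theorem elfsProb_nonneg (hv : G.IsPotential M (unitMass x) v) (hx : x ∉ M) (hR : 0 < v x)
    (y : V) : 0 ≤ G.elfsProb M x y := by
  rw [elfsProb_eq hv hx]
  have := G.sqGradient_nonneg v y
  positivity

/-- The drift of the elfs process on the mean hitting time of the random walk is half the escape
time. -/
theorem sum_elfsProb_mul (hv : G.IsPotential M (unitMass x) v) (hx : x ∉ M) (hR : 0 < v x)
    (hh : G.IsPotential M (fun _ => d) h) :
    ∑ y, G.elfsProb M x y * h y = h x - d * (∑ y, v y ^ 2) / (2 * v x) := by
  have h1 := G.sum_mul_sqGradient h v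
  have h2 : ∑ y, h y * (v y * G.lap v y) = h x * v x := by
    rw [← sum_mul_unitMass x fun y => h y * v y]
    exact Finset.sum_congr rfl fun y _ => by rw [hv.mul_lap hv.eq_zero]; ring
  have h3 : ∑ y, v y ^ 2 * G.lap h y = d * ∑ y, v y ^ 2 := by
    rw [Finset.mul_sum]
    refine Finset.sum_congr rfl fun y _ => ?_
    rw [hh.mul_lap (u' := fun y => v y ^ 2) fun z hz => by rw [hv.eq_zero z hz]; ring]
    ring
  rw [h2, h3] at h1
  have h4 : ∑ y, G.elfsProb M x y * h y = 1 / (2 * v x) * ∑ y, h y * G.sqGradient v y := by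
    rw [Finset.mul_sum]
    exact Finset.sum_congr rfl fun y _ => by rw [elfsProb_eq hv hx]; ring
  rw [h4, h1]
  field_simp

/-- From every vertex the elfs process hits the sink in one step with probability at least
`1 / (2 R d m)`. -/
theorem one_le_mul_sum_sink_elfsProb (hG : G.IsRegular d)
    (hv : G.IsPotential M (unitMass x) v) (hx : x ∉ M) (hR : 0 < v x) :
    1 ≤ 2 * v x * d * M.card * ∑ y ∈ M, G.elfsProb M x y := by
  have h1 : ∑ a ∈ M, G.lap v a = -1 := by
    rw [← (isUnitFlow_current hv hx).sink, ← Finset.sum_neg_distrib]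
    refine Finset.sum_congr rfl fun a _ => ?_
    rw [lap, ← Finset.sum_neg_distrib]
    exact Finset.sum_congr rfl fun y _ => by rw [current, G.symm y a]; ring
  have h2 : ∑ a ∈ M, G.lap v a ^ 2 ≤ d * ∑ a ∈ M, G.sqGradient v a := by
    rw [Finset.mul_sum]
    exact Finset.sum_le_sum fun a _ => (G.sq_lap_le v a).trans_eq (by rw [hG a])
  -- Cauchy–Schwarz twice: over the edges at each sink vertex (`h2`), then over the vertices of the
  -- sink, which absorb unit current in total.
  have h3 := sq_sum_le_card_mul_sum_sq (s := M) (f := G.lap v)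
  rw [h1] at h3
  simp only [elfsProb_eq hv hx, ← Finset.mul_sum]
  have h4 := mul_le_mul_of_nonneg_left h2 (Nat.cast_nonneg (α := ℝ) M.card)
  have h5 : 2 * v x * d * M.card * (1 / (2 * v x) * ∑ y ∈ M, G.sqGradient v y) =
      M.card * (d * ∑ y ∈ M, G.sqGradient v y) := by
    field_simp
  rw [h5]
  linarith

/-- One step of the lazy random walk on functions. -/
def lazy (G : WeightedGraph V) (d : ℝ) (f : V → ℝ) (x : V) : ℝ := f x - G.lap f x / (2 * d)

theorem lazy_eq (hd : 0 < d) (hG : G.IsRegular d) (f : V → ℝ) (x : V) :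
    G.lazy d f x = f x / 2 + (∑ y, G.w x y * f y) / (2 * d) := by
  rw [lazy, G.lap_eq, hG x]
  field_simp
  ring

theorem lazy_mono (hd : 0 < d) (hG : G.IsRegular d) {f g : V → ℝ} (hfg : ∀ y, f y ≤ g y) (x : V) :
    G.lazy d f x ≤ G.lazy d g x := by
  rw [lazy_eq hd hG, lazy_eq hd hG]
  have : ∑ y, G.w x y * f y ≤ ∑ y, G.w x y * g y :=
    Finset.sum_le_sum fun y _ => mul_le_mul_of_nonneg_left (hfg y) (G.nonneg x y)
  have := hfg x
  gcongr

theorem lazy_add_const (f : V → ℝ) (c : ℝ) (x : V) :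
    G.lazy d (fun y => f y + c) x = G.lazy d f x + c := by
  have := G.lap_sub_const f (-c) x
  simp only [sub_neg_eq_add] at this
  rw [lazy, lazy, this]
  ring

theorem sum_lazy (f : V → ℝ) : ∑ y, G.lazy d f y = ∑ y, f y := by
  simp only [lazy, Finset.sum_sub_distrib, ← Finset.sum_div, G.sum_lap, zero_div, sub_zero]

/-- Laziness makes the second-order term at most half the first-order one, so no control of the
bottom of the walk's spectrum is needed. -/
theorem sum_lazy_sq_le (hd : 0 < d) (hG : G.IsRegular d) (hgap : G.HasSpectralGap δ) {f : V → ℝ}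
    (hf : ∑ x, f x = 0) : ∑ x, G.lazy d f x ^ 2 ≤ Real.exp (-(δ / 2)) * ∑ x, f x ^ 2 := by
  have h1 := poincare hd hG hgap hf
  have h2 : ∑ x, G.lap f x ^ 2 ≤ 2 * d * ∑ x, f x * G.lap f x := by
    have : ∑ x, G.lap f x ^ 2 ≤ d * ∑ x, G.sqGradient f x := by
      rw [Finset.mul_sum]
      exact Finset.sum_le_sum fun a _ => (G.sq_lap_le f a).trans_eq (by rw [hG a])
    have e := G.sum_mul_lap_self f
    rw [e]
    linarith
  have h3 : ∑ x, G.lazy d f x ^ 2 = ∑ x, f x ^ 2 - (∑ x, f x * G.lap f x) / d +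
      (∑ x, G.lap f x ^ 2) / (4 * d ^ 2) := by
    simp only [Finset.sum_div, ← Finset.sum_sub_distrib, ← Finset.sum_add_distrib]
    refine Finset.sum_congr rfl fun x _ => ?_
    rw [lazy]
    field_simp
    ring
  have h4 : (∑ x, G.lap f x ^ 2) / (4 * d ^ 2) ≤ (∑ x, f x * G.lap f x) / (2 * d) := by
    rw [div_le_div_iff₀ (by positivity) (by positivity)]
    nlinarith
  have h5 : δ / 2 * ∑ x, f x ^ 2 ≤ (∑ x, f x * G.lap f x) / (2 * d) := by
    rw [le_div_iff₀ (by positivity)]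
    linarith
  have h6 : (∑ x, f x * G.lap f x) / d = 2 * ((∑ x, f x * G.lap f x) / (2 * d)) := by
    field_simp
  have h7 : (1 - δ / 2) * ∑ x, f x ^ 2 ≤ Real.exp (-(δ / 2)) * ∑ x, f x ^ 2 := by
    refine mul_le_mul_of_nonneg_right ?_ (Finset.sum_nonneg fun x _ => sq_nonneg _)
    have := Real.add_one_le_exp (-(δ / 2))
    linarith
  rw [h3]
  linarith

theorem iterate_lazy_sq_le (hd : 0 < d) (hG : G.IsRegular d) (hgap : G.HasSpectralGap δ)
    {f : V → ℝ} (hf : ∑ x, f x = 0) (t : ℕ) : ∑ x, (G.lazy d)^[t] f x = 0 ∧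
      ∑ x, (G.lazy d)^[t] f x ^ 2 ≤ Real.exp (-(δ / 2) * t) * ∑ x, f x ^ 2 := by
  induction t with
  | zero => simp [hf]
  | succ t ih =>
    simp only [Function.iterate_succ_apply']
    refine ⟨(sum_lazy _).trans ih.1, (sum_lazy_sq_le hd hG hgap ih.1).trans ?_⟩
    have : Real.exp (-(δ / 2) * (t + 1 : ℕ)) =
        Real.exp (-(δ / 2)) * Real.exp (-(δ / 2) * t) := by
      rw [← Real.exp_add]
      push_cast
      ring_nf
    rw [this, mul_assoc]
    exact mul_le_mul_of_nonneg_left ih.2 (Real.exp_pos _).le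

/-- A lazy step lowers `h` by exactly `1 / 2` off `M` and cannot lower it on `M`. Splitting off the
mean leaves the iterates a mean-zero function to contract. -/
theorem le_iterate_lazy (hd : 0 < d) (hG : G.IsRegular d) (hh : G.IsPotential M (fun _ => d) h)
    (h0 : ∀ y, 0 ≤ h y) (t : ℕ) (x : V) :
    h x ≤ (G.lazy d)^[t] (fun y => h y - mean h) x + mean h + t / 2 := by
  induction t generalizing x with
  | zero => simp
  | succ t ih =>
    have h1 : h x ≤ G.lazy d h x + 1 / 2 := by
      by_cases hx : x ∈ M
      · rw [hh.eq_zero x hx, lazy_eq hd hG]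
        have : 0 ≤ ∑ y, G.w x y * h y :=
          Finset.sum_nonneg fun y _ => mul_nonneg (G.nonneg x y) (h0 y)
        have := h0 x
        positivity
      · rw [lazy, hh.lap_eq x hx]
        refine le_of_eq ?_
        field_simp
        ring
    have h2 := lazy_mono hd hG ih x
    simp only [add_assoc] at h2
    rw [lazy_add_const, ← Function.iterate_succ_apply' (G.lazy d)] at h2
    push_cast
    linarith

/-- The energy of `h` is linear in its mean, whereas its zeros on `M` make the fluctuation at least
`m * mean²`; comparing the two bounds the mean. -/
theorem card_mul_mean_hitting_le (hδ : 0 < δ) (hd : 0 < d) (hG : G.IsRegular d)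
    (hgap : G.HasSpectralGap δ) (hh : G.IsPotential M (fun _ => d) h) :
    δ * ∑ y, (h y - mean h) ^ 2 ≤ Fintype.card V * mean h ∧
      δ * (M.card * mean h) ≤ Fintype.card V := by
  have h1 := poincare_mean hd hG hgap h
  rw [hh.energy_eq, ← Finset.sum_mul, ← card_mul_mean h] at h1
  have h2 : δ * ∑ y, (h y - mean h) ^ 2 ≤ Fintype.card V * mean h := by
    refine le_of_mul_le_mul_right ?_ hd
    linarith
  refine ⟨h2, ?_⟩
  have h3 := mul_le_mul_of_nonneg_left (card_mul_mean_sq_le hh.eq_zero) hδ.le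
  by_cases hm : 0 < mean h
  · refine le_of_mul_le_mul_right ?_ hm
    linarith
  · refine le_trans (mul_nonpos_of_nonneg_of_nonpos hδ.le
      (mul_nonpos_of_nonneg_of_nonpos (Nat.cast_nonneg _) (not_lt.1 hm))) (Nat.cast_nonneg _)

/-- The hitting time of a set of `m` among `n` vertices of an expander is
`O(n / m + log n)`. -/
theorem hitting_le (hδ : 0 < δ) (hd : 0 < d) (hG : G.IsRegular d)
    (hgap : G.HasSpectralGap δ) (hM : M.Nonempty) (hh : G.IsPotential M (fun _ => d) h) (x : V) :
    h x ≤ (2 / δ + 1) * ((Fintype.card V : ℝ) / M.card + Real.log (Fintype.card V)) := by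
  set n : ℝ := (Fintype.card V : ℝ) with hn
  set m : ℝ := (M.card : ℝ) with hm
  have hm1 : 1 ≤ m := by
    rw [hm]
    exact_mod_cast hM.card_pos
  have hmn : m ≤ n := by
    rw [hm, hn]
    exact_mod_cast Finset.card_le_univ M
  have hn1 : 1 ≤ n := hm1.trans hmn
  have hnm : 1 ≤ n / m := by rwa [one_le_div (by linarith)]
  have h0 := hh.nonneg hδ hd hG hgap hM fun _ => hd.le
  obtain ⟨h1, h2⟩ := card_mul_mean_hitting_le hδ hd hG hgap hh
  rw [← hn] at h1 h2
  rw [← hm] at h2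
  have hmean : mean h ≤ 1 / δ * (n / m) := by
    rw [one_div_mul_eq_div, le_div_iff₀ hδ, le_div_iff₀ (by linarith)]
    linarith
  have hmean' : mean h ≤ n / δ := by
    refine hmean.trans ?_
    rw [one_div_mul_eq_div]
    gcongr
    exact div_le_self (by linarith) hm1
  have hlog : 0 ≤ Real.log n := Real.log_nonneg hn1
  -- Chosen so that the contraction `exp (-δ t / 2) ≤ n⁻²` cancels the a priori bound `n² / δ²` on
  -- the squared fluctuation.
  set t : ℕ := ⌈4 / δ * Real.log n⌉₊ with ht
  have ht1 : 4 / δ * Real.log n ≤ t := Nat.le_ceil _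
  have ht2 : (t : ℝ) < 4 / δ * Real.log n + 1 := Nat.ceil_lt_add_one (by positivity)
  have h3 := le_iterate_lazy hd hG hh h0 t x
  obtain ⟨-, h4⟩ := iterate_lazy_sq_le hd hG hgap (sum_sub_mean h) t
  have h5 : (G.lazy d)^[t] (fun y => h y - mean h) x ^ 2 ≤ (1 / δ) ^ 2 := by
    have e1 : Real.exp (-(δ / 2) * t) ≤ (n ^ 2)⁻¹ := by
      rw [← Real.exp_log (by positivity : 0 < (n ^ 2)⁻¹), Real.log_inv, Real.log_pow]
      refine Real.exp_le_exp.2 ?_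
      have := mul_le_mul_of_nonneg_left ht1 (half_pos hδ).le
      have e : δ / 2 * (4 / δ * Real.log n) = 2 * Real.log n := by
        field_simp
        ring
      push_cast
      linarith
    have e2 : ∑ y, (h y - mean h) ^ 2 ≤ n ^ 2 / δ ^ 2 := by
      have : n * mean h ≤ n * (n / δ) := mul_le_mul_of_nonneg_left hmean' (by linarith)
      have := h1.trans this
      rw [le_div_iff₀ (by positivity)]
      have e3 : n * (n / δ) * δ = n ^ 2 := by field_simp
      nlinarith
    calc _ ≤ ∑ y, (G.lazy d)^[t] (fun y => h y - mean h) y ^ 2 :=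
          Finset.single_le_sum (f := fun y => (G.lazy d)^[t] (fun y => h y - mean h) y ^ 2)
            (fun y _ => sq_nonneg _) (Finset.mem_univ x)
      _ ≤ _ := h4
      _ ≤ (n ^ 2)⁻¹ * (n ^ 2 / δ ^ 2) := mul_le_mul e1 e2
          (Finset.sum_nonneg fun y _ => sq_nonneg _) (by positivity)
      _ = (1 / δ) ^ 2 := by field_simp
  have h6 : (G.lazy d)^[t] (fun y => h y - mean h) x ≤ 1 / δ :=
    (abs_le_of_sq_le_sq' h5 (by positivity)).2
  have h7 : 1 / δ ≤ 1 / δ * (n / m) := le_mul_of_one_le_right (by positivity) hnm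
  have e : (2 / δ + 1) * (n / m + Real.log n) =
      1 / δ * (n / m) + 1 / δ * (n / m) + n / m + (4 / δ * Real.log n) / 2 + Real.log n := by
    ring
  rw [e]
  linarith

/-- The escape time is `O(1 + h(x)² / n)`, where `h` is the mean hitting time. -/
theorem escape_le (hδ : 0 < δ) (hd : 0 < d) (hG : G.IsRegular d)
    (hgap : G.HasSpectralGap δ) (hM : M.Nonempty) (hv : G.IsPotential M (unitMass x) v)
    (hx : x ∉ M) (hh : G.IsPotential M (fun _ => d) h) :
    d * (∑ y, v y ^ 2) / v x ≤ 1 / δ + h x ^ 2 / Fintype.card V := by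
  have h1 := one_le_degree_mul_resistance hδ hd hG hgap hM hv hx
  have hR : 0 < v x := pos_of_mul_pos_right (zero_lt_one.trans_le h1) hd.le
  have h2 := sum_sub_mean_sq_le_resistance hd hG hgap hv
  have hn : (0 : ℝ) < Fintype.card V := by
    exact_mod_cast Fintype.card_pos_iff.2 ⟨x⟩
  have h3 : h x = d * (Fintype.card V * mean v) := by
    have := hv.reciprocity hh
    rw [sum_mul_unitMass, ← Finset.sum_mul, ← card_mul_mean v] at this
    rw [this, mul_comm]
  have h4 : h x ^ 2 / Fintype.card V = d ^ 2 * (Fintype.card V * mean v ^ 2) := by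
    rw [h3]
    field_simp
  rw [sum_sq_eq v, h4, div_le_iff₀ hR, mul_add]
  have h5 : d * ∑ y, (v y - mean v) ^ 2 ≤ 1 / δ * v x := by
    rw [one_div_mul_eq_div, le_div_iff₀ hδ]
    linarith
  have h6 : 0 ≤ (Fintype.card V : ℝ) * mean v ^ 2 := by positivity
  -- The factor `1 ≤ d * v x` turns the mean part `d * n * mean²` into `h x² / n` times `v x`.
  nlinarith [mul_nonneg (mul_nonneg hd.le h6) (sub_nonneg.2 h1)]

end Bounds

/-! ### Mean times of the walk and of the elfs process. -/

section Times

variable {V : Type*} [Fintype V] [MeasurableSpace V] [DiscreteMeasurableSpace V]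
  {G : WeightedGraph V} {d δ : ℝ} {M : Finset V} {x : V} {v h : V → ℝ}

theorem lintegral_stepKernel_walkProb (hd : 0 < d) (hG : G.IsRegular d) {u : V → ℝ}
    (hu : ∀ y, 0 ≤ u y) (x : V) :
    ∫⁻ y, ENNReal.ofReal (u y) ∂stepKernel G.walkProb x =
      ENNReal.ofReal (u x - G.lap u x / d) := by
  rw [lintegral_stepKernel_ofReal (fun y => ?_) ?_ hu, sum_walkProb_mul hd hG]
  · have := sum_walkProb_mul hd hG (fun _ => 1) x
    simpa [lap] using this
  · rw [walkProb, hG x]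
    exact div_nonneg (G.nonneg x y) hd.le

theorem one_add_ofReal_le {a b : ℝ} (ha : 0 ≤ a) (hab : 1 + a ≤ b) :
    1 + ENNReal.ofReal a ≤ ENNReal.ofReal b := by
  rw [← ENNReal.ofReal_one, ← ENNReal.ofReal_add zero_le_one ha]
  exact ENNReal.ofReal_le_ofReal hab

theorem hittingTime_le (hd : 0 < d) (hG : G.IsRegular d) (hh : G.IsPotential M (fun _ => d) h)
    (h0 : ∀ y, 0 ≤ h y) (x : V) : G.hittingTime M x ≤ ENNReal.ofReal (h x) := by
  refine lintegral_firstHit_le _ _ _ (fun y => ENNReal.ofReal (h y)) fun y hy => ?_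
  have h1 : h y - G.lap h y / d = h y - 1 := by rw [hh.lap_eq y hy, div_self hd.ne']
  have h2 : 0 ≤ h y - G.lap h y / d := by
    rw [← sum_walkProb_mul hd hG]
    refine Finset.sum_nonneg fun z _ => mul_nonneg ?_ (h0 z)
    rw [walkProb, hG y]
    exact div_nonneg (G.nonneg y z) hd.le
  rw [lintegral_stepKernel_walkProb hd hG h0]
  exact one_add_ofReal_le h2 (by linarith)

theorem escapeTime_of_mem (hx : x ∈ M) : G.escapeTime M x = 0 := by
  classical
  -- The budget may be infinite off `M`, as only its value at the starting point in `M` counts.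
  refine le_antisymm ((lintegral_lastExit_le _ _ M (fun _ => 1) (fun y => if y ∈ M then 0 else ⊤)
    le_rfl (fun y _ _ => by simp) fun y hy => ?_).trans_eq (if_pos hx)) zero_le
  rw [if_neg hy]
  exact le_top

/-- The function `v / v x` is harmonic off `M` and `x`, so it serves as the return probability `u`.
The budget `l` is the potential that loses `u` in each step, and reciprocity evaluates it at `x`. -/
theorem escapeTime_le (hδ : 0 < δ) (hd : 0 < d) (hG : G.IsRegular d)
    (hgap : G.HasSpectralGap δ) (hM : M.Nonempty) (hv : G.IsPotential M (unitMass x) v)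
    (hx : x ∉ M) : G.escapeTime M x ≤ ENNReal.ofReal (d * (∑ y, v y ^ 2) / v x) := by
  have hR : 0 < v x := pos_of_mul_pos_right
    (zero_lt_one.trans_le (one_le_degree_mul_resistance hδ hd hG hgap hM hv hx)) hd.le
  have hv0 := hv.nonneg hδ hd hG hgap hM (unitMass_nonneg x)
  have hu0 : ∀ y, 0 ≤ v y / v x := fun y => div_nonneg (hv0 y) hR.le
  obtain ⟨l, hl⟩ := exists_isPotential hδ hd hG hgap hM fun y => d * (v y / v x)
  have hl0 := hl.nonneg hδ hd hG hgap hM fun y => mul_nonneg hd.le (hu0 y)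
  have hlx : l x = d * (∑ y, v y ^ 2) / v x := by
    have := hv.reciprocity hl
    rw [sum_mul_unitMass] at this
    rw [this, Finset.mul_sum, Finset.sum_div]
    exact Finset.sum_congr rfl fun y _ => by ring
  rw [← hlx]
  refine lintegral_lastExit_le _ _ M (fun y => ENNReal.ofReal (v y / v x))
    (fun y => ENNReal.ofReal (l y)) ?_ (fun y hy hyx => ?_) fun y hy => ?_
  · simp [div_self hR.ne']
  · rw [lintegral_stepKernel_walkProb hd hG hu0]
    have h1 : G.lap (fun z => v z / v x) y = 0 := by
      have : G.lap (fun z => v z / v x) y = G.lap v y / v x := by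
        simp only [lap, Finset.sum_div]
        exact Finset.sum_congr rfl fun z _ => by ring
      rw [this, hv.lap_eq y hy, unitMass_of_ne hyx, zero_div]
    rw [h1, zero_div, sub_zero]
  · have h1 : l y - G.lap l y / d = l y - v y / v x := by
      rw [hl.lap_eq y hy, mul_div_cancel_left₀ _ hd.ne']
    have h2 : 0 ≤ l y - v y / v x := by
      rw [← h1, ← sum_walkProb_mul hd hG]
      refine Finset.sum_nonneg fun z _ => mul_nonneg ?_ (hl0 z)
      rw [walkProb, hG y]
      exact div_nonneg (G.nonneg y z) hd.le
    rw [lintegral_stepKernel_walkProb hd hG hl0, h1, ← ENNReal.ofReal_add (hu0 y) h2]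
    exact ENNReal.ofReal_le_ofReal (by linarith)

theorem electricHittingTime_le_hitting (hδ : 0 < δ) (hd : 0 < d) (hG : G.IsRegular d)
    (hgap : G.HasSpectralGap δ) (hM : M.Nonempty) (hh : G.IsPotential M (fun _ => d) h) (x : V) :
    G.electricHittingTime M x ≤ ENNReal.ofReal (2 * h x) := by
  have h0 : ∀ y, 0 ≤ 2 * h y := fun y =>
    mul_nonneg zero_le_two (hh.nonneg hδ hd hG hgap hM (fun _ => hd.le) y)
  refine lintegral_firstHit_le _ _ M (fun y => ENNReal.ofReal (2 * h y)) fun y hy => ?_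
  obtain ⟨v, hv⟩ := exists_isPotential hδ hd hG hgap hM (unitMass y)
  have h1 := one_le_degree_mul_resistance hδ hd hG hgap hM hv hy
  have hR : 0 < v y := pos_of_mul_pos_right (zero_lt_one.trans_le h1) hd.le
  have hp := elfsProb_nonneg hv hy hR
  have h2 := sum_elfsProb_mul hv hy hR hh
  rw [lintegral_stepKernel_ofReal hp (sum_elfsProb hv hy hR) h0]
  refine one_add_ofReal_le (Finset.sum_nonneg fun z _ => mul_nonneg (hp z) (h0 z)) ?_
  simp only [mul_left_comm _ (2 : ℝ), ← Finset.mul_sum, h2]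
  have h3 : v y ^ 2 ≤ ∑ z, v z ^ 2 :=
    Finset.single_le_sum (f := fun z => v z ^ 2) (fun z _ => sq_nonneg _) (Finset.mem_univ y)
  -- The single term `z = y` already gives drift `d * v y / 2 ≥ 1 / 2`, hence the factor `2` in
  -- front of `h`.
  have h4 : 1 / 2 ≤ d * (∑ z, v z ^ 2) / (2 * v y) := by
    rw [div_le_div_iff₀ two_pos (by positivity)]
    nlinarith [mul_le_mul_of_nonneg_left h3 hd.le, mul_le_mul_of_nonneg_right h1 hR.le]
  linarith

-- A constant off `M` is a Lyapunov function because each step is absorbed with probability at least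
-- `δ / (4 * m)`, by `one_le_mul_sum_sink_elfsProb` and `resistance_le`.
open Classical in
theorem electricHittingTime_le_card (hδ : 0 < δ) (hd : 0 < d) (hG : G.IsRegular d)
    (hgap : G.HasSpectralGap δ) (hM : M.Nonempty) (x : V) :
    G.electricHittingTime M x ≤ ENNReal.ofReal (4 / δ * M.card) := by
  set A : ℝ := 4 / δ * M.card with hA
  have hA0 : 0 ≤ A := by positivity
  let φ : V → ℝ := fun y => if y ∈ M then 0 else A
  have h0 : ∀ y, 0 ≤ φ y := fun y => by
    simp only [φ]
    split_ifs
    exacts [le_rfl, hA0]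
  refine (lintegral_firstHit_le _ _ M (fun y => ENNReal.ofReal (φ y)) fun y hy => ?_).trans
    (ENNReal.ofReal_le_ofReal ?_)
  · obtain ⟨v, hv⟩ := exists_isPotential hδ hd hG hgap hM (unitMass y)
    have h1 := one_le_degree_mul_resistance hδ hd hG hgap hM hv hy
    have hR : 0 < v y := pos_of_mul_pos_right (zero_lt_one.trans_le h1) hd.le
    have hp := elfsProb_nonneg hv hy hR
    rw [lintegral_stepKernel_ofReal hp (sum_elfsProb hv hy hR) h0]
    refine one_add_ofReal_le (Finset.sum_nonneg fun z _ => mul_nonneg (hp z) (h0 z)) ?_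
    have h2 : ∑ z, G.elfsProb M y z * φ z = A - A * ∑ z ∈ M, G.elfsProb M y z := by
      have e : ∀ z, G.elfsProb M y z * φ z =
          A * G.elfsProb M y z - if z ∈ M then A * G.elfsProb M y z else 0 := fun z => by
        simp only [φ]
        split_ifs <;> ring
      simp only [e, Finset.sum_sub_distrib, ← Finset.mul_sum, sum_elfsProb hv hy hR,
        Finset.sum_ite_mem, Finset.univ_inter, mul_one]
    have h3 := one_le_mul_sum_sink_elfsProb hG hv hy hR
    have h4 : 2 * v y * d * M.card ≤ A := by
      have := resistance_le hδ hd hG hgap hM hv hy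
      rw [hA]
      refine mul_le_mul_of_nonneg_right ?_ (Nat.cast_nonneg _)
      rw [le_div_iff₀ hδ]
      linarith
    have h5 := mul_le_mul_of_nonneg_right h4
      (Finset.sum_nonneg fun z (_ : z ∈ M) => hp z)
    have h6 : φ y = A := if_neg hy
    rw [h2, h6]
    linarith
  · simp only [φ]
    split_ifs
    exacts [hA0, le_rfl]

end Times

end WeightedGraph

/-! ### Collecting the constants. -/

theorem sq_log_le {n : ℝ} (hn : 0 < n) (h1 : 1 ≤ n) : Real.log n ^ 2 ≤ 4 * n := by
  have h2 := Real.log_le_sub_one_of_pos (Real.sqrt_pos.2 hn)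
  rw [Real.log_sqrt hn.le] at h2
  have h3 := Real.log_nonneg h1
  have h4 := Real.sq_sqrt hn.le
  have h5 : Real.log n ≤ 2 * √n := by linarith
  calc Real.log n ^ 2 ≤ (2 * √n) ^ 2 := pow_le_pow_left₀ h3 h5 2
    _ = 4 * n := by rw [mul_pow, h4]; norm_num

end

theorem mainTheorem11 (δ d₀ D : ℝ) (hδ : 0 < δ) (hd₀ : 0 < d₀) :
    ∃ c C : ℝ, 0 < c ∧ 0 < C ∧
      ∀ (V : Type*) [Fintype V] [MeasurableSpace V] [DiscreteMeasurableSpace V]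
        (G : WeightedGraph V) (d : ℝ), d₀ ≤ d → d ≤ D →
        G.IsRegular d → G.HasSpectralGap δ →
        ∀ (M : Finset V) (n m : ℕ), M.Nonempty → Fintype.card V = n → M.card = m →
        ∀ x : V,
          (x ∉ M → c ≤ G.effectiveResistance M x) ∧
          G.effectiveResistance M x ≤ C ∧
          G.escapeTime M x ≤ ENNReal.ofReal (C * (1 + (n : ℝ) / (m : ℝ) ^ 2)) ∧
          G.electricHittingTime M x ≤
            ENNReal.ofReal (C * min (m : ℝ) ((n : ℝ) / (m : ℝ) + Real.log (n : ℝ))) ∧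
          G.hittingTime M x ≤ ENNReal.ofReal (C * ((n : ℝ) / (m : ℝ) + Real.log (n : ℝ))) := by
  set K : ℝ := 2 / δ + 1 with hK
  have hK0 : 0 < K := by positivity
  -- One summand each for the resistance, the escape time, and the two electric hitting bounds; the
  -- last also covers the hitting time.
  set C : ℝ := 2 / (δ * d₀) + (1 / δ + 8 * K ^ 2) + 4 / δ + 2 * K with hC
  have hC1 : 2 / (δ * d₀) ≤ C := by
    have : 0 ≤ (1 / δ + 8 * K ^ 2) + 4 / δ + 2 * K := by positivity
    linarith
  have hC2 : 1 / δ + 8 * K ^ 2 ≤ C := by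
    have : 0 ≤ 2 / (δ * d₀) + 4 / δ + 2 * K := by positivity
    linarith
  have hC3 : 4 / δ ≤ C := by
    have : 0 ≤ 2 / (δ * d₀) + (1 / δ + 8 * K ^ 2) + 2 * K := by positivity
    linarith
  have hC4 : 2 * K ≤ C := by
    have : 0 ≤ 2 / (δ * d₀) + (1 / δ + 8 * K ^ 2) + 4 / δ := by positivity
    linarith
  have hC0 : 0 < C := by positivity
  refine ⟨1 / (|D| + 1), C, by positivity, hC0, ?_⟩
  intro V _ _ _ G d hd₁ hd₂ hG hgap M n m hM hn hm x
  subst hn hm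
  have hd : 0 < d := hd₀.trans_le hd₁
  have hm1 : (1 : ℝ) ≤ M.card := by exact_mod_cast hM.card_pos
  have hmn : (M.card : ℝ) ≤ Fintype.card V := by exact_mod_cast Finset.card_le_univ M
  have hn1 : (1 : ℝ) ≤ Fintype.card V := hm1.trans hmn
  obtain ⟨h, hh⟩ := WeightedGraph.exists_isPotential hδ hd hG hgap hM fun _ => d
  obtain ⟨v, hv⟩ :=
    WeightedGraph.exists_isPotential hδ hd hG hgap hM (WeightedGraph.unitMass x)
  have h0 := hh.nonneg hδ hd hG hgap hM fun _ => hd.le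
  have hhx := WeightedGraph.hitting_le hδ hd hG hgap hM hh x
  rw [← hK] at hhx
  have hB : (0 : ℝ) ≤ (Fintype.card V : ℝ) / M.card + Real.log (Fintype.card V) :=
    add_nonneg (by positivity) (Real.log_nonneg hn1)
  refine ⟨fun hx => ?_, ?_, ?_, ?_, ?_⟩
  · rw [WeightedGraph.effectiveResistance_eq hv hx, div_le_iff₀ (by positivity)]
    have h1 := WeightedGraph.one_le_degree_mul_resistance hδ hd hG hgap hM hv hx
    have h2 : d ≤ |D| + 1 := by linarith [le_abs_self D]
    have hR : 0 ≤ v x := hv.nonneg hδ hd hG hgap hM (WeightedGraph.unitMass_nonneg x) x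
    nlinarith [mul_le_mul_of_nonneg_right h2 hR]
  · by_cases hx : x ∈ M
    · rw [WeightedGraph.effectiveResistance_of_mem hx]
      exact hC0.le
    · rw [WeightedGraph.effectiveResistance_eq hv hx]
      refine le_trans ?_ hC1
      rw [le_div_iff₀ (by positivity)]
      have h1 := WeightedGraph.resistance_le hδ hd hG hgap hM hv hx
      have hR : 0 ≤ v x := hv.nonneg hδ hd hG hgap hM (WeightedGraph.unitMass_nonneg x) x
      nlinarith [mul_le_mul_of_nonneg_left hd₁ (mul_nonneg hδ.le hR)]
  · by_cases hx : x ∈ M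
    · rw [WeightedGraph.escapeTime_of_mem hx]
      exact zero_le
    · refine (WeightedGraph.escapeTime_le hδ hd hG hgap hM hv hx).trans
        (ENNReal.ofReal_le_ofReal
          ((WeightedGraph.escape_le hδ hd hG hgap hM hv hx hh).trans ?_))
      have h1 := pow_le_pow_left₀ (h0 x) hhx 2
      have h2 := sq_log_le (by linarith) hn1
      set N : ℝ := (Fintype.card V : ℝ)
      set m : ℝ := (M.card : ℝ)
      have hN : 0 < N := by linarith
      have hm0 : 0 < m := by linarith
      -- After division by `N`, the logarithm contributes only a constant since `log² N ≤ 4 * N`;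
      -- this is why no logarithm survives in the escape time.
      have h3 : (N / m + Real.log N) ^ 2 ≤ N * (8 * (1 + N / m ^ 2)) := by
        have e : N * (N / m ^ 2) = (N / m) ^ 2 := by ring
        have : N * (8 * (1 + N / m ^ 2)) = 8 * N + 8 * (N / m) ^ 2 := by rw [← e]; ring
        rw [this]
        nlinarith [sq_nonneg (N / m - Real.log N), sq_nonneg (N / m)]
      have h4 : h x ^ 2 / N ≤ 8 * K ^ 2 * (1 + N / m ^ 2) := by
        rw [div_le_iff₀ hN]
        refine h1.trans ?_
        rw [mul_pow]
        have := mul_le_mul_of_nonneg_left h3 (sq_nonneg K)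
        linarith
      have h5 : 0 ≤ N / m ^ 2 := by positivity
      have h6 : 1 / δ ≤ 1 / δ * (1 + N / m ^ 2) :=
        le_mul_of_one_le_right (by positivity) (by linarith)
      have h7 := mul_le_mul_of_nonneg_right hC2 (by linarith : 0 ≤ 1 + N / m ^ 2)
      linarith
  · rcases min_choice (M.card : ℝ)
      ((Fintype.card V : ℝ) / M.card + Real.log (Fintype.card V)) with hmin | hmin <;> rw [hmin]
    · refine (WeightedGraph.electricHittingTime_le_card hδ hd hG hgap hM x).trans
        (ENNReal.ofReal_le_ofReal ?_)
      exact mul_le_mul_of_nonneg_right hC3 (Nat.cast_nonneg _)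
    · refine (WeightedGraph.electricHittingTime_le_hitting hδ hd hG hgap hM hh x).trans
        (ENNReal.ofReal_le_ofReal ?_)
      have := mul_le_mul_of_nonneg_right hC4 hB
      linarith
  · refine (WeightedGraph.hittingTime_le hd hG hh h0 x).trans (ENNReal.ofReal_le_ofReal ?_)
    refine hhx.trans (mul_le_mul_of_nonneg_right ?_ hB)
    linarith
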